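/- Let $\rho>0$ and let $\mathcal N$ be a homogeneous Poisson point process in $\mathbb R^2$ with intensity $1$. Write $O$ for the origin, $|\cdot|$ for the Euclidean norm and $B(x,s)$ for the open ball with center $x$ and radius $s$. \emph{Radial Poisson Tree.} $\mathcal T_\rho$ is the oriented graph with vertex set $(\mathcal N\setminus B(O,\rho))\cup\{O\}$ and root $O$, in which the ancestor (end of the out-going edge) of a vertex $X\neq O$ is the point of $\mathcal N\setminus B(O,\rho)$ with the largest Euclidean norm in $$\mathrm{Cyl}(X,\rho)=\big([O;X]\oplus B(O,\rho)\big)\cap B(O,|X|)$$ (where $\oplus$ is the Minkowski sum), and is $O$ if $\mathrm{Cyl}(X,\rho)$ contains no such point. \emph{Directed forest.} $\mathcal F_\rho$ is the oriented graph with vertex set $\mathcal N$, in which the ancestor of $X\in\mathcal N$ is the point of $\mathcal N\setminus\{X\}$ with the largest abscissa in $X+(-\infty;0]\times[-\rho;\rho]$. (These ancestors are almost surely well defined.) \emph{Local functions.} Consider the oriented graphs $G$ with a locally finite vertex set $V(G)\subset\mathbb R^2$ and at most one out-going edge at each vertex, with the $\sigma$-algebra generated by the numbers of vertices in Borel sets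 and the numbers of edges from one Borel set to another. Let $F=F(X,G)$ be a function of a point $X\in\mathbb R^2$ and such a graph $G$, with values in a measurable space and measurable in $G$. It is called local if there is a deterministic $L>0$ such that, for all $X$, $G$, $G'$, one has $F(X,G)=F(X,G')$ whenever $V(G)$ and $V(G')$ differ by at most finitely many points, all outside $B(X,L)$, and each vertex in $B(X,L)$ has the same ancestor (or no ancestor) in $G$ and in $G'$. It is called translation invariant if $F(X+z,G+z)=F(X,G)$ for all $X$, $G$ and all $z\in\mathbb R^2$. \textbf{Proposition.} Let $F$ be a local and translation invariant function. Then, for any $\delta>0$, the total variation distance between the laws of $F((r,0),\mathcal T_\rho)$ and $F(O,\mathcal F_\rho)$ satisfies, as $r\to\infty$, $$d_{TV}\Big(F((r,0),\mathcal T_\rho),\,F(O,\mathcal F_\rho)\Big)=\mathcal O\big(r^{-1+\delta}\big).$$ -/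

import Mathlib

open MeasureTheory ProbabilityTheory Set Filter Asymptotics
open scoped Pointwise Topology

noncomputable section

namespace RadialPoisson

/-- The Euclidean plane. -/
abbrev Plane : Type := EuclideanSpace ℝ (Fin 2)

/-- A subset of the plane is locally finite if its trace on every bounded set is finite. -/
def LocFinite (S : Set Plane) : Prop :=
  ∀ B : Set Plane, Bornology.IsBounded B → (S ∩ B).Finite

/-- Locally finite configurations of (distinct) points of the plane. -/
structure Config where
  pts : Set Plane
  locFinite : LocFinite pts

/-- The usual σ-algebra on configurations: the one generated by the numbers of points in
Borel sets. -/
instance Config.instMeasurableSpace : MeasurableSpace Config :=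
  MeasurableSpace.generateFrom
    {S | ∃ (B : Set Plane) (k : ℕ∞), MeasurableSet B ∧ S = {c | (c.pts ∩ B).encard = k}}

/-- `N` is a homogeneous Poisson point process with intensity `1` in the plane. -/
structure IsPoissonProcess {Ω : Type*} [MeasurableSpace Ω] (P : Measure Ω)
    (N : Ω → Config) : Prop where
  measurable : Measurable N
  /-- The number of points in a bounded Borel set is Poisson distributed, with the area of the
  set as its parameter. -/
  law_count : ∀ B : Set Plane, MeasurableSet B → Bornology.IsBounded B →
    P.map (fun ω => ((N ω).pts ∩ B).ncard) = poissonMeasure (volume B).toNNReal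
  /-- The numbers of points in pairwise disjoint sets are independent. -/
  indep_count : ∀ (n : ℕ) (B : Fin n → Set Plane),
    (∀ i, MeasurableSet (B i)) → (∀ i, Bornology.IsBounded (B i)) →
    Pairwise (fun i j => Disjoint (B i) (B j)) →
    iIndepFun (fun i ω => ((N ω).pts ∩ B i).ncard) P

/-- Oriented graphs with a locally finite vertex set in the plane, each vertex having at most one
out-going edge. `anc v = some w` means that the out-going edge of the vertex `v` ends at its
ancestor `w`; `anc v = none` means that there is no edge out of `v` (a root, or not a vertex). -/
@[ext]
structure OutGraph where
  verts : Set Plane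
  locFinite : LocFinite verts
  anc : Plane → Option Plane
  source_mem : ∀ v w, anc v = some w → v ∈ verts
  target_mem : ∀ v w, anc v = some w → w ∈ verts

/-- The σ-algebra on graphs generated by the number of vertices in a Borel set and the number of
edges that start in one Borel set and end in another one. -/
instance OutGraph.instMeasurableSpace : MeasurableSpace OutGraph :=
  MeasurableSpace.generateFrom
    ({S | ∃ (B : Set Plane) (k : ℕ∞), MeasurableSet B ∧
        S = {G | (G.verts ∩ B).encard = k}} ∪
     {S | ∃ (B C : Set Plane) (k : ℕ∞), MeasurableSet B ∧ MeasurableSet C ∧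
        S = {G | {v | v ∈ B ∧ ∃ w ∈ C, G.anc v = some w}.encard = k}})

theorem LocFinite.translate {S : Set Plane} (hS : LocFinite S) (z : Plane) :
    LocFinite {v | v - z ∈ S} := by
  intro B hB
  have h : ((fun v : Plane => v - z) '' ({v | v - z ∈ S} ∩ B)).Finite := by
    refine (hS ((fun v : Plane => v - z) '' B) ?_).subset ?_
    · obtain ⟨R, hR⟩ := hB.exists_norm_le
      refine isBounded_iff_forall_norm_le.2 ⟨R + ‖z‖, ?_⟩
      rintro _ ⟨v, hv, rfl⟩
      exact (norm_sub_le v z).trans (by linarith [hR v hv])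
    · rintro _ ⟨v, ⟨hv, hvB⟩, rfl⟩
      exact ⟨hv, v, hvB, rfl⟩
  exact h.of_finite_image (sub_left_injective.injOn)

/-- The graph `G` translated by the vector `z`. -/
def OutGraph.translate (z : Plane) (G : OutGraph) : OutGraph where
  verts := {v | v - z ∈ G.verts}
  locFinite := G.locFinite.translate z
  anc v := (G.anc (v - z)).map (fun w => w + z)
  source_mem := by
    intro v w h
    obtain ⟨u, hu, -⟩ := Option.map_eq_some_iff.1 h
    exact G.source_mem _ _ hu
  target_mem := by
    intro v w h
    obtain ⟨u, hu, rfl⟩ := Option.map_eq_some_iff.1 h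
    simpa using G.target_mem _ _ hu

/-- `F` is local: for some deterministic `L > 0`, `F X G` does not change when the graph is
modified without touching the vertices in the ball `B(X, L)` and their ancestors. The vertex set
may stay the same, or change by finitely many points outside `B(X, L)`; the latter makes it
possible to compare a rooted tree with a forest, which has no root among its vertices. -/
def IsLocal {E : Type*} (F : Plane → OutGraph → E) : Prop :=
  ∃ L : ℝ, 0 < L ∧ ∀ (X : Plane) (G G' : OutGraph),
    (symmDiff G.verts G'.verts).Finite →
    G.verts ∩ Metric.ball X L = G'.verts ∩ Metric.ball X L →
    (∀ v ∈ G.verts ∩ Metric.ball X L, G.anc v = G'.anc v) →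
    F X G = F X G'

/-- `F` is translation invariant: `F X G` only depends on `G` as seen from `X`. -/
def IsTranslationInvariant {E : Type*} (F : Plane → OutGraph → E) : Prop :=
  ∀ (z X : Plane) (G : OutGraph), F (X + z) (G.translate z) = F X G

open Classical in
/-- The point of `S` at which `f` is largest, if there is exactly one, and `none` otherwise. -/
def argmax (f : Plane → ℝ) (S : Set Plane) : Option Plane :=
  if h : ∃! y, y ∈ S ∧ ∀ z ∈ S, f z ≤ f y then some h.choose else none

theorem argmax_mem {f : Plane → ℝ} {S : Set Plane} {y : Plane} (h : argmax f S = some y) :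
    y ∈ S := by
  unfold argmax at h
  split_ifs at h with h'
  obtain rfl := Option.some.inj h
  exact h'.choose_spec.1.1

/-- `Cyl(X, ρ) = ([O ; X] ⊕ B(O, ρ)) ∩ B(O, |X|)`. -/
def cyl (ρ : ℝ) (X : Plane) : Set Plane :=
  (segment ℝ 0 X + Metric.ball 0 ρ) ∩ Metric.ball 0 ‖X‖

open Classical in
/-- The Radial Poisson Tree with parameter `ρ` built on the configuration `c`: the points of `c` in
`B(O, ρ)` are removed, the root `O` is added, and the ancestor of a vertex `X ≠ O` is the vertex
of largest norm in `Cyl(X, ρ)`, or `O` if there is none. (The ancestor is also set to `O` when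
there are ties, an event of probability zero for the Poisson process.) -/
def radialPoissonTree (ρ : ℝ) (c : Config) : OutGraph where
  verts := insert 0 (c.pts \ Metric.ball 0 ρ)
  locFinite := by
    intro B hB
    refine ((c.locFinite B hB).insert 0).subset ?_
    rintro v ⟨rfl | hv, hvB⟩
    · exact Or.inl rfl
    · exact Or.inr ⟨hv.1, hvB⟩
  anc X :=
    if X ∈ c.pts \ Metric.ball 0 ρ then
      some ((argmax (fun Y => ‖Y‖) (cyl ρ X ∩ (c.pts \ Metric.ball 0 ρ))).getD 0)
    else none
  source_mem := by
    intro v w h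
    split_ifs at h with hv
    exact Or.inr hv
  target_mem := by
    intro v w h
    split_ifs at h with hv
    obtain rfl := Option.some.inj h
    cases hy : argmax (fun Y => ‖Y‖) (cyl ρ v ∩ (c.pts \ Metric.ball 0 ρ)) with
    | none => exact Or.inl rfl
    | some y => exact Or.inr (argmax_mem hy).2

/-- The half-strip `X + (-∞ ; 0] × [-ρ ; ρ]`. -/
def halfStrip (ρ : ℝ) (X : Plane) : Set Plane :=
  {Y | Y 0 ≤ X 0 ∧ |Y 1 - X 1| ≤ ρ}

open Classical in
/-- The directed forest with direction `-(1, 0)` and parameter `ρ` built on the configuration `c`: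
the ancestor of `X` is the other point of `c` in the half-strip on the left of `X` that has
the largest abscissa. (For the Poisson process it exists and is unique almost surely.) -/
def directedForest (ρ : ℝ) (c : Config) : OutGraph where
  verts := c.pts
  locFinite := c.locFinite
  anc X :=
    if X ∈ c.pts then argmax (fun Y => Y 0) ((c.pts \ {X}) ∩ halfStrip ρ X) else none
  source_mem := by
    intro v w h
    split_ifs at h with hv
    exact hv
  target_mem := by
    intro v w h
    split_ifs at h with hv
    exact (argmax_mem h).1.1

/-- The total variation distance between the laws under `P` of two random elements of `E`:
the supremum over measurable `A` of `|P(f ∈ A) - P(g ∈ A)|`. -/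
def tvDistLaw {Ω E : Type*} [MeasurableSpace Ω] [MeasurableSpace E] (P : Measure Ω)
    (f g : Ω → E) : ℝ :=
  ⨆ A : {A : Set E // MeasurableSet A}, |P.real (f ⁻¹' A.1) - P.real (g ⁻¹' A.1)|

end RadialPoisson

end

/-!
The tree seen from `(r, 0)` is compared with the forest seen from the same point; by stationarity of
the Poisson process and translation invariance of `F`, moving the viewpoint of the forest to the
origin does not change the law of `F`. For this the law of the Poisson process has to be determined
by its intensity (`IsPoissonProcess.map_eq`, by cutting finitely many bounded sets into disjoint
atoms) and the forest has to be measurable in the configuration (`measurable_directedForest`, by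
enumerating the points of the configuration along a countable basis of the topology).

As `F` is local, with radius `L` say, the two values at `(r, 0)` agree as soon as each point `v` of
the configuration in `B((r, 0), L)` has the same ancestor in both graphs. Let `h` be a small power
of `r`. In the box `[r - h, r + m] × [-m, m]`, with `m` a constant, the cylinder of `v` differs from
its half-strip by a vertical displacement `O(h / r)`, and norms are ordered as abscissae up to
`O(1 / r)`. Hence the ancestors agree (`Scales.anc_eq`) outside three events:

* two points of the box have abscissae at distance `O(1 / r)`: probability `O(h / r)`;
* two points of the box have ordinates whose distance is `ρ + O(h / r)`: probability `O(h ^ 3 / r)`;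
* a horizontal row in the left part of the box, of height `ρ / 2` and length of order `h`, is empty,
  so that the search for the ancestor may leave the box: probability exponentially small in `h`.

The first two probabilities are bounded by covering the box with `O(h * r)` narrow columns, or with
`O(r / h)` narrow rows, and by using the Poisson law of the counts and their independence. The
choice `h = r ^ (min δ 1 / 3)` gives the rate `r ^ (-1 + δ)`.
-/

noncomputable section

namespace RadialPoisson

/-! ### Measurability of the directed forest -/

theorem argmax_eq_some_iff {f : Plane → ℝ} {S : Set Plane} {y : Plane} :
    argmax f S = some y ↔ y ∈ S ∧ ∀ z ∈ S, z ≠ y → f z < f y := by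
  constructor
  · intro h
    unfold argmax at h
    split_ifs at h with h'
    obtain rfl := Option.some.inj h
    obtain ⟨hy, hu⟩ := h'.choose_spec
    refine ⟨hy.1, fun z hz hne => lt_of_le_of_ne (hy.2 z hz) fun he => hne ?_⟩
    exact hu z ⟨hz, fun w hw => (hy.2 w hw).trans he.ge⟩
  · rintro ⟨hy, hlt⟩
    have h' : ∃! y, y ∈ S ∧ ∀ z ∈ S, f z ≤ f y := by
      refine ⟨y, ⟨hy, fun z hz => ?_⟩, fun w hw => ?_⟩
      · by_cases h : z = y
        · rw [h]
        · exact (hlt z hz h).le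
      · by_contra h
        exact absurd (hw.2 y hy) (not_le.2 (hlt w hw.1 h))
    unfold argmax
    rw [dif_pos h']
    congr 1
    exact h'.unique h'.choose_spec.1
      ⟨hy, fun z hz => (eq_or_ne z y).elim (fun h => h ▸ le_rfl) fun h => (hlt z hz h).le⟩

theorem measurableSet_encard_eq {B : Set Plane} (hB : MeasurableSet B) (k : ℕ∞) :
    MeasurableSet {c : Config | (c.pts ∩ B).encard = k} :=
  MeasurableSpace.measurableSet_generateFrom ⟨B, k, hB, rfl⟩

/-- The unique point of `c` in `U` when there is exactly one, and the junk value `0` otherwise. As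
`U` runs over a countable basis of the topology, these maps enumerate the points of `c`. -/
def pointIn (U : Set Plane) (c : Config) : Plane :=
  if h : (c.pts ∩ U).encard = 1 then (encard_eq_one.1 h).choose else 0

theorem inter_eq_singleton_pointIn {U : Set Plane} {c : Config} (h : (c.pts ∩ U).encard = 1) :
    c.pts ∩ U = {pointIn U c} := by
  have := (encard_eq_one.1 h).choose_spec
  unfold pointIn
  rwa [dif_pos h]

theorem pointIn_mem {U : Set Plane} {c : Config} (h : (c.pts ∩ U).encard = 1) :
    pointIn U c ∈ c.pts := by
  have : pointIn U c ∈ c.pts ∩ U := by rw [inter_eq_singleton_pointIn h]; rfl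
  exact this.1

theorem measurable_pointIn {U : Set Plane} (hU : MeasurableSet U) : Measurable (pointIn U) := by
  classical
  intro B hB
  have h1 := measurableSet_encard_eq hU 1
  have h2 := measurableSet_encard_eq (hU.inter hB) 1
  have : pointIn U ⁻¹' B = ({c | (c.pts ∩ U).encard = 1} ∩ {c | (c.pts ∩ (U ∩ B)).encard = 1}) ∪
      ({c | (c.pts ∩ U).encard = 1}ᶜ ∩ {_c | (0 : Plane) ∈ B}) := by
    ext c
    by_cases h : (c.pts ∩ U).encard = 1
    · have hs := inter_eq_singleton_pointIn h
      simp only [mem_preimage, mem_union, mem_inter_iff, mem_ofPred_eq, mem_compl_iff,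
        ← inter_assoc, hs]
      by_cases hb : pointIn U c ∈ B
      · simp [hb, singleton_inter_of_mem hb]
      · simp [hb]
    · have : pointIn U c = 0 := by unfold pointIn; rw [dif_neg h]
      simp [h, this]
  rw [this]
  exact (h1.inter h2).union (h1.compl.inter (MeasurableSet.const _))

/-- The points of a locally finite set are isolated, so each of them is the only one in some set of
a countable basis. -/
theorem exists_pointIn_eq {c : Config} {v : Plane} (hv : v ∈ c.pts) :
    ∃ U : TopologicalSpace.countableBasis Plane,
      (c.pts ∩ U.1).encard = 1 ∧ pointIn U.1 c = v := by
  have hfin : ((c.pts ∩ Metric.ball v 1) \ {v}).Finite :=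
    (c.locFinite _ Metric.isBounded_ball).sdiff
  have hopen : IsOpen (Metric.ball v 1 \ ((c.pts ∩ Metric.ball v 1) \ {v})) :=
    Metric.isOpen_ball.sdiff hfin.isClosed
  have hmem : v ∈ Metric.ball v 1 \ ((c.pts ∩ Metric.ball v 1) \ {v}) :=
    ⟨Metric.mem_ball_self one_pos, by simp⟩
  obtain ⟨U, hU, hvU, hUs⟩ :=
    (TopologicalSpace.isBasis_countableBasis Plane).exists_subset_of_mem_open hmem hopen
  have hs : c.pts ∩ U = {v} := by
    ext w
    simp only [mem_inter_iff, mem_singleton_iff]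
    constructor
    · rintro ⟨hw, hwU⟩
      by_contra hne
      exact (hUs hwU).2 ⟨⟨hw, (hUs hwU).1⟩, hne⟩
    · rintro rfl
      exact ⟨hv, hvU⟩
  have h1 : (c.pts ∩ U).encard = 1 := encard_eq_one.2 ⟨v, hs⟩
  refine ⟨⟨U, hU⟩, h1, ?_⟩
  have := inter_eq_singleton_pointIn h1
  rw [hs] at this
  exact (singleton_injective this).symm

theorem measurableSet_of_mem_countableBasis (U : TopologicalSpace.countableBasis Plane) :
    MeasurableSet U.1 :=
  (TopologicalSpace.isOpen_of_mem_countableBasis U.2).measurableSet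

theorem measurableSet_eq_of_forall_le {α : Type*} [MeasurableSpace α] {f : α → ℕ∞}
    (hle : ∀ n : ℕ, MeasurableSet {c | (n : ℕ∞) ≤ f c}) (k : ℕ∞) :
    MeasurableSet {c | f c = k} := by
  induction k using ENat.recTopCoe with
  | top =>
    have : {c | f c = ⊤} = ⋂ n : ℕ, {c | (n : ℕ∞) ≤ f c} := by
      ext c
      simp only [mem_ofPred_eq, mem_iInter]
      exact ⟨fun h n => h ▸ le_top, fun h => ENat.eq_top_iff_forall_ge.2 h⟩
    rw [this]
    exact MeasurableSet.iInter hle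
  | coe n =>
    have : {c | f c = n} =
        {c | (n : ℕ∞) ≤ f c} \ {c | ((n + 1 : ℕ) : ℕ∞) ≤ f c} := by
      ext c
      simp only [mem_ofPred_eq, Set.mem_sdiff, not_le]
      push_cast
      rw [ENat.lt_add_one_iff (ENat.natCast_ne_top n)]
      exact ⟨fun h => ⟨h.ge, h.le⟩, fun h => le_antisymm h.2 h.1⟩
    rw [this]
    exact (hle n).diff (hle (n + 1))

/-- The number of points in a random subset of the configuration is measurable as soon as it can
be decided measurably which of the enumerated points belong to the subset. -/
theorem measurableSet_encard_subset_eq {s : Config → Set Plane} (hs : ∀ c, s c ⊆ c.pts)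
    (hm : ∀ U : TopologicalSpace.countableBasis Plane,
      MeasurableSet {c : Config | (c.pts ∩ U.1).encard = 1 ∧ pointIn U.1 c ∈ s c}) (k : ℕ∞) :
    MeasurableSet {c | (s c).encard = k} := by
  have hle : ∀ n : ℕ, MeasurableSet {c | (n : ℕ∞) ≤ (s c).encard} := by
    intro n
    have : {c | (n : ℕ∞) ≤ (s c).encard} =
        ⋃ U : Fin n → TopologicalSpace.countableBasis Plane,
          (⋂ a, {c : Config | (c.pts ∩ (U a).1).encard = 1 ∧ pointIn (U a).1 c ∈ s c}) ∩
          ⋂ a, ⋂ b, {c : Config | a ≠ b → pointIn (U a).1 c ≠ pointIn (U b).1 c} := by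
      ext c
      simp only [mem_ofPred_eq, mem_iUnion, mem_inter_iff, mem_iInter]
      constructor
      · intro h
        obtain ⟨t, hts, htn⟩ := exists_subset_encard_eq h
        have htf : t.Finite := finite_of_encard_eq_coe htn
        have hcard : t.ncard = n := by rw [ncard, htn]; rfl
        have e : Fin n ≃ t := by
          haveI := htf.to_subtype
          exact (Finite.equivFinOfCardEq hcard).symm
        choose U h1 h2 using fun a : Fin n => exists_pointIn_eq (hs c (hts (e a).2))
        refine ⟨U, fun a => ⟨h1 a, by rw [h2]; exact hts (e a).2⟩, fun a b hab => ?_⟩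
        rw [h2, h2]
        exact fun h => hab (e.injective (Subtype.ext h))
      · rintro ⟨U, hU, hne⟩
        have hinj : Function.Injective fun a => pointIn (U a).1 c := by
          intro a b hab
          by_contra h
          exact hne a b h hab
        have hsub : range (fun a => pointIn (U a).1 c) ⊆ s c := by
          rintro _ ⟨a, rfl⟩
          exact (hU a).2
        refine le_trans ?_ (encard_le_encard hsub)
        rw [← image_univ, hinj.encard_image]
        simp
    rw [this]
    refine MeasurableSet.iUnion fun U => (MeasurableSet.iInter fun a => hm _).inter
      (MeasurableSet.iInter fun a => MeasurableSet.iInter fun b => ?_)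
    by_cases hab : a = b
    · simp [hab]
    · simp only [ne_eq, hab, not_false_eq_true, forall_const]
      exact (measurableSet_eq_fun (measurable_pointIn (measurableSet_of_mem_countableBasis _))
        (measurable_pointIn (measurableSet_of_mem_countableBasis _))).compl
  exact measurableSet_eq_of_forall_le hle k

theorem directedForest_anc_eq_some_iff {ρ : ℝ} {c : Config} {v w : Plane} :
    (directedForest ρ c).anc v = some w ↔ v ∈ c.pts ∧ w ∈ (c.pts \ {v}) ∩ halfStrip ρ v ∧
      ∀ z ∈ (c.pts \ {v}) ∩ halfStrip ρ v, z ≠ w → z 0 < w 0 := by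
  by_cases hv : v ∈ c.pts
  · simp only [directedForest, hv, true_and]
    exact argmax_eq_some_iff
  · simp [directedForest, hv]

theorem measurable_directedForest (ρ : ℝ) : Measurable (directedForest ρ) := by
  refine measurable_generateFrom ?_
  rintro _ (⟨B, k, hB, rfl⟩ | ⟨B, C, k, hB, hC, rfl⟩)
  · exact measurableSet_encard_eq hB k
  refine measurableSet_encard_subset_eq
    (s := fun c => {v | v ∈ B ∧ ∃ w ∈ C, (directedForest ρ c).anc v = some w})
    (fun c v hv => (directedForest ρ c).source_mem _ _ hv.2.choose_spec.2) (fun U => ?_) k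
  set p : TopologicalSpace.countableBasis Plane → Config → Prop :=
    fun U c => (c.pts ∩ U.1).encard = 1 with hp
  set x : TopologicalSpace.countableBasis Plane → Config → Plane := fun U => pointIn U.1 with hx
  have hpm : ∀ U, MeasurableSet {c | p U c} := fun U =>
    measurableSet_encard_eq (measurableSet_of_mem_countableBasis U) 1
  have hxm : ∀ U, Measurable (x U) := fun U =>
    measurable_pointIn (measurableSet_of_mem_countableBasis U)
  have hcoord : ∀ (i : Fin 2), Measurable fun v : Plane => v i := fun i => by fun_prop
  have hstrip : ∀ U V, MeasurableSet {c | x V c ∈ halfStrip ρ (x U c)} := fun U V => by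
    simp only [halfStrip, mem_ofPred_eq]
    exact (measurableSet_le ((hcoord 0).comp (hxm V)) ((hcoord 0).comp (hxm U))).inter
      (measurableSet_le (((hcoord 1).comp (hxm V)).sub ((hcoord 1).comp (hxm U))).norm
        measurable_const)
  have hne : ∀ U V, MeasurableSet {c | x V c ≠ x U c} := fun U V =>
    (measurableSet_eq_fun (hxm V) (hxm U)).compl
  have key : {c : Config | (c.pts ∩ U.1).encard = 1 ∧
      pointIn U.1 c ∈ {v | v ∈ B ∧ ∃ w ∈ C, (directedForest ρ c).anc v = some w}} =
      {c | p U c} ∩ (x U ⁻¹' B ∩ ⋃ V, {c | p V c} ∩ (x V ⁻¹' C ∩ ({c | x V c ≠ x U c} ∩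
        ({c | x V c ∈ halfStrip ρ (x U c)} ∩ ⋂ W, ({c | p W c}ᶜ ∪ ({c | x W c ≠ x U c}ᶜ ∪
          ({c | x W c ∈ halfStrip ρ (x U c)}ᶜ ∪ ({c | x W c ≠ x V c}ᶜ ∪
            {c | x W c 0 < x V c 0})))))))) := by
    ext c
    simp only [mem_ofPred_eq, mem_inter_iff, mem_iUnion, mem_iInter, mem_union, mem_compl_iff,
      mem_preimage]
    refine and_congr_right fun hU => and_congr_right fun _ => ?_
    have hxU : x U c ∈ c.pts := pointIn_mem hU
    have hanc : ∀ w, (directedForest ρ c).anc (x U c) = some w ↔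
        w ∈ (c.pts \ {x U c}) ∩ halfStrip ρ (x U c) ∧
          ∀ z ∈ (c.pts \ {x U c}) ∩ halfStrip ρ (x U c), z ≠ w → z 0 < w 0 := by
      intro w
      rw [directedForest_anc_eq_some_iff, and_iff_right hxU]
    constructor
    · rintro ⟨w, hwC, hw⟩
      obtain ⟨⟨⟨hw1, hw2⟩, hw3⟩, hw4⟩ := (hanc w).1 hw
      obtain ⟨V, hV, rfl⟩ := exists_pointIn_eq hw1
      refine ⟨V, hV, hwC, hw2, hw3, fun W => ?_⟩
      by_contra! hcon
      obtain ⟨h1, h2, h3, h4, h5⟩ := hcon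
      exact absurd (hw4 (x W c) ⟨⟨pointIn_mem h1, h2⟩, h3⟩ h4) (not_lt.2 h5)
    · rintro ⟨V, hV, hVC, h2, h3, h4⟩
      refine ⟨x V c, hVC, (hanc _).2 ⟨⟨⟨pointIn_mem hV, h2⟩, h3⟩, ?_⟩⟩
      rintro z ⟨⟨hz1, hz2⟩, hz3⟩ hz4
      obtain ⟨W, hW, rfl⟩ := exists_pointIn_eq hz1
      rcases h4 W with h | h | h | h | h
      · exact absurd hW h
      · exact absurd hz2 h
      · exact absurd hz3 h
      · exact absurd hz4 h
      · exact h
  rw [key]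
  refine (hpm U).inter ((hxm U hB).inter (MeasurableSet.iUnion fun V => (hpm V).inter
    ((hxm V hC).inter ((hne U V).inter ((hstrip U V).inter (MeasurableSet.iInter fun W =>
      (hpm W).compl.union ((hne U W).compl.union ((hstrip U W).compl.union
        ((hne V W).compl.union (measurableSet_lt ((hcoord 0).comp (hxm W))
          ((hcoord 0).comp (hxm V))))))))))))

/-! ### Stationarity -/

/-- The configuration `c` translated by the vector `z`. -/
def Config.translate (z : Plane) (c : Config) : Config where
  pts := {v | v - z ∈ c.pts}
  locFinite := c.locFinite.translate z

theorem Config.translate_pts_inter (z : Plane) (c : Config) (B : Set Plane) :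
    (c.translate z).pts ∩ B = (fun v => v + z) '' (c.pts ∩ (fun v => v + z) ⁻¹' B) := by
  ext v
  simp only [Config.translate, mem_inter_iff, mem_ofPred_eq, mem_image, mem_preimage]
  constructor
  · rintro ⟨h1, h2⟩
    exact ⟨v - z, ⟨h1, by simpa using h2⟩, by simp⟩
  · rintro ⟨w, ⟨h1, h2⟩, rfl⟩
    exact ⟨by simpa using h1, h2⟩

theorem Config.encard_translate_inter (z : Plane) (c : Config) (B : Set Plane) :
    ((c.translate z).pts ∩ B).encard = (c.pts ∩ (fun v => v + z) ⁻¹' B).encard := by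
  rw [Config.translate_pts_inter, (add_left_injective z).encard_image]

theorem Config.ncard_translate_inter (z : Plane) (c : Config) (B : Set Plane) :
    ((c.translate z).pts ∩ B).ncard = (c.pts ∩ (fun v => v + z) ⁻¹' B).ncard := by
  rw [ncard, ncard, Config.encard_translate_inter]

theorem Config.measurable_translate (z : Plane) : Measurable (Config.translate z) := by
  refine measurable_generateFrom ?_
  rintro _ ⟨B, k, hB, rfl⟩
  simp only [preimage_ofPred_eq, Config.encard_translate_inter]
  exact measurableSet_encard_eq (hB.preimage (measurable_add_const z)) k

theorem directedForest_translate (ρ : ℝ) (z : Plane) (c : Config) :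
    directedForest ρ (c.translate z) = (directedForest ρ c).translate z := by
  have hanc : ∀ v w, (directedForest ρ (c.translate z)).anc v = some w ↔
      ((directedForest ρ c).translate z).anc v = some w := by
    intro v w
    simp only [OutGraph.translate, Option.map_eq_some_iff, directedForest_anc_eq_some_iff,
      Config.translate]
    constructor
    · rintro ⟨h0, ⟨⟨h1, h2⟩, h3⟩, h4⟩
      refine ⟨w - z, ⟨h0, ⟨⟨h1, fun h => h2 (sub_left_injective h)⟩, ?_⟩, ?_⟩, by simp⟩
      · simpa [halfStrip] using h3
      · rintro y ⟨⟨hy1, hy2⟩, hy3⟩ hy4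
        have := h4 (y + z) ⟨⟨by simpa using hy1, fun h => hy2 ?_⟩, ?_⟩ fun h => hy4 ?_
        · simp only [PiLp.add_apply, PiLp.sub_apply] at this ⊢; linarith
        · rw [mem_singleton_iff] at h ⊢; rw [← h]; simp
        · simp only [halfStrip, mem_ofPred_eq, PiLp.add_apply, PiLp.sub_apply] at hy3 ⊢
          refine ⟨by linarith [hy3.1], ?_⟩
          rw [show y 1 + z 1 - v 1 = y 1 - (v 1 - z 1) by ring]
          exact hy3.2
        · rw [← h]; simp
    · rintro ⟨u, ⟨h0, ⟨⟨h1, h2⟩, h3⟩, h4⟩, rfl⟩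
      refine ⟨h0, ⟨⟨by simpa using h1, fun h => h2 ?_⟩, ?_⟩, ?_⟩
      · rw [mem_singleton_iff] at h ⊢; rw [← h]; simp
      · simp only [halfStrip, mem_ofPred_eq, PiLp.add_apply, PiLp.sub_apply] at h3 ⊢
        refine ⟨by linarith [h3.1], ?_⟩
        rw [show u 1 + z 1 - v 1 = u 1 - (v 1 - z 1) by ring]
        exact h3.2
      · rintro y ⟨⟨hy1, hy2⟩, hy3⟩ hy4
        have := h4 (y - z) ⟨⟨hy1, fun h => hy2 (sub_left_injective h)⟩,
          by simpa [halfStrip] using hy3⟩ fun h => hy4 (by rw [← h]; simp)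
        simp only [PiLp.add_apply, PiLp.sub_apply] at this ⊢; linarith
  refine OutGraph.ext rfl ?_
  funext v
  exact Option.ext fun w => hanc v w

theorem measurable_ncard {B : Set Plane} (hB : MeasurableSet B) (hb : Bornology.IsBounded B) :
    Measurable fun c : Config => (c.pts ∩ B).ncard := by
  refine measurable_to_countable' fun n => ?_
  have : (fun c : Config => (c.pts ∩ B).ncard) ⁻¹' {n} = {c | (c.pts ∩ B).encard = n} := by
    ext c
    simp only [mem_preimage, mem_singleton_iff, mem_ofPred_eq]
    rw [← (c.locFinite B hb).cast_ncard_eq]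
    exact Nat.cast_inj.symm
  rw [this]
  exact measurableSet_encard_eq hB n

variable {Ω : Type*} [MeasurableSpace Ω] {P : Measure Ω} {N : Ω → Config}

theorem IsPoissonProcess.measurable_count (hN : IsPoissonProcess P N) {B : Set Plane}
    (hB : MeasurableSet B) (hb : Bornology.IsBounded B) :
    Measurable fun ω => ((N ω).pts ∩ B).ncard :=
  (measurable_ncard hB hb).comp hN.measurable

theorem IsPoissonProcess.translate (hN : IsPoissonProcess P N) (z : Plane) :
    IsPoissonProcess P (fun ω => (N ω).translate z) := by
  have hm : ∀ B : Set Plane, MeasurableSet B → MeasurableSet ((fun v => v + z) ⁻¹' B) :=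
    fun B hB => hB.preimage (measurable_add_const z)
  have hb : ∀ B : Set Plane, Bornology.IsBounded B →
      Bornology.IsBounded ((fun v => v + z) ⁻¹' B) := by
    intro B hB
    obtain ⟨R, hR⟩ := hB.exists_norm_le
    refine isBounded_iff_forall_norm_le.2 ⟨R + ‖z‖, fun v hv => ?_⟩
    have h := norm_sub_le (v + z) z
    rw [add_sub_cancel_right] at h
    linarith [hR _ hv]
  refine ⟨(Config.measurable_translate z).comp hN.measurable, fun B hB hB' => ?_,
    fun n B hB hB' hd => ?_⟩
  · simp only [Config.ncard_translate_inter]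
    rw [hN.law_count _ (hm B hB) (hb B hB'), measure_preimage_add_right]
  · simp only [Config.ncard_translate_inter]
    exact hN.indep_count n _ (fun i => hm _ (hB i)) (fun i => hb _ (hB' i))
      fun i j hij => (hd hij).preimage _

/-- The events that prescribe the numbers of points in finitely many bounded Borel sets. -/
def countCylinders : Set (Set Config) :=
  {S | ∃ t : Finset (Set Plane × ℕ),
    (∀ b ∈ t, MeasurableSet b.1 ∧ Bornology.IsBounded b.1) ∧
    S = {c | ∀ b ∈ t, (c.pts ∩ b.1).ncard = b.2}}

theorem isPiSystem_countCylinders : IsPiSystem countCylinders := by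
  classical
  rintro _ ⟨t, ht, rfl⟩ _ ⟨t', ht', rfl⟩ -
  refine ⟨t ∪ t', fun b hb => (Finset.mem_union.1 hb).elim (ht b) (ht' b), ?_⟩
  ext c
  simp only [mem_inter_iff, mem_ofPred_eq, Finset.mem_union, or_imp, forall_and]

theorem generateFrom_countCylinders :
    Config.instMeasurableSpace = MeasurableSpace.generateFrom countCylinders := by
  apply le_antisymm
  · refine MeasurableSpace.generateFrom_le ?_
    rintro _ ⟨B, k, hB, rfl⟩
    refine @measurableSet_eq_of_forall_le _ (MeasurableSpace.generateFrom countCylinders)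
      (fun c => (c.pts ∩ B).encard) (fun n => ?_) k
    have : {c : Config | (n : ℕ∞) ≤ (c.pts ∩ B).encard} =
        ⋃ m : ℕ, (⋃ j : Fin n, {c : Config | ∀ b ∈ ({(B ∩ Metric.closedBall 0 m, (j : ℕ))} :
          Finset (Set Plane × ℕ)), (c.pts ∩ b.1).ncard = b.2})ᶜ := by
      ext c
      simp only [Finset.mem_singleton, forall_eq, mem_ofPred_eq, mem_iUnion, mem_compl_iff,
        not_exists]
      have hfin : ∀ m : ℕ, (c.pts ∩ (B ∩ Metric.closedBall 0 m)).Finite := fun m =>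
        c.locFinite _ (Metric.isBounded_closedBall.subset inter_subset_right)
      constructor
      · intro h
        obtain ⟨t, hts, htn⟩ := exists_subset_encard_eq h
        have htf : t.Finite := finite_of_encard_eq_coe htn
        obtain ⟨R, hR⟩ := htf.isBounded.exists_norm_le
        obtain ⟨m, hm⟩ := exists_nat_ge R
        refine ⟨m, fun j hj => ?_⟩
        have hsub : t ⊆ c.pts ∩ (B ∩ Metric.closedBall 0 m) := fun v hv =>
          ⟨(hts hv).1, (hts hv).2, by simpa using (hR v hv).trans hm⟩
        have h1 := ncard_le_ncard hsub (hfin m)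
        have h2 : t.ncard = n := by rw [ncard, htn]; rfl
        have := j.2
        omega
      · rintro ⟨m, hm⟩
        have h1 : n ≤ (c.pts ∩ (B ∩ Metric.closedBall 0 m)).ncard := by
          by_contra! hlt
          exact hm ⟨_, hlt⟩ rfl
        calc (n : ℕ∞) ≤ ((c.pts ∩ (B ∩ Metric.closedBall 0 m)).ncard : ℕ∞) := by
              exact_mod_cast h1
          _ = (c.pts ∩ (B ∩ Metric.closedBall 0 m)).encard := (hfin m).cast_ncard_eq
          _ ≤ _ := encard_le_encard (inter_subset_inter_right _ inter_subset_left)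
    rw [this]
    refine MeasurableSet.iUnion fun m => (MeasurableSet.iUnion fun j => ?_).compl
    refine MeasurableSpace.measurableSet_generateFrom ⟨_, fun b hb => ?_, rfl⟩
    obtain rfl := Finset.mem_singleton.1 hb
    exact ⟨hB.inter Metric.isClosed_closedBall.measurableSet,
      Metric.isBounded_closedBall.subset inter_subset_right⟩
  · refine MeasurableSpace.generateFrom_le ?_
    rintro _ ⟨t, ht, rfl⟩
    have : {c : Config | ∀ b ∈ t, (c.pts ∩ b.1).ncard = b.2} =
        ⋂ b ∈ t, {c : Config | (c.pts ∩ b.1).ncard = b.2} := by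
      ext c; simp
    rw [this]
    exact Finset.measurableSet_biInter t fun b hb =>
      measurable_ncard (ht b hb).1 (ht b hb).2 (measurableSet_singleton b.2)

variable {N' : Ω → Config}

theorem IsPoissonProcess.iIndepFun_count (hN : IsPoissonProcess P N)
    {κ : Type*} [Fintype κ] {A : κ → Set Plane} (hA : ∀ s, MeasurableSet (A s))
    (hb : ∀ s, Bornology.IsBounded (A s)) (hd : Pairwise fun s t => Disjoint (A s) (A t)) :
    iIndepFun (fun s ω => ((N ω).pts ∩ A s).ncard) P := by
  have e := Fintype.equivFin κ
  have h := (hN.indep_count (Fintype.card κ) (fun i => A (e.symm i)) (fun i => hA _)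
    (fun i => hb _) fun i j hij => hd (e.symm.injective.ne hij)).precomp e.injective
  simpa using h

/-- Any finite family of bounded sets is cut into the disjoint atoms that it generates; the counts
in the sets are sums of the independent Poisson counts in the atoms. Hence the joint law of the
counts does not depend on the Poisson process. -/
theorem IsPoissonProcess.map_count_eq [IsProbabilityMeasure P] (hN : IsPoissonProcess P N)
    (hN' : IsPoissonProcess P N') {ι : Type*} [Fintype ι] {B : ι → Set Plane}
    (hB : ∀ i, MeasurableSet (B i)) (hb : ∀ i, Bornology.IsBounded (B i)) :
    P.map (fun ω i => ((N ω).pts ∩ B i).ncard) = P.map (fun ω i => ((N' ω).pts ∩ B i).ncard) := by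
  classical
  let A : {s : Finset ι // s.Nonempty} → Set Plane := fun s => {v | ∀ i, v ∈ B i ↔ i ∈ s.1}
  have hA : ∀ s, MeasurableSet (A s) := by
    intro s
    have : A s = ⋂ i, {v | v ∈ B i ↔ i ∈ s.1} := by ext v; simp [A]
    rw [this]
    refine MeasurableSet.iInter fun i => ?_
    by_cases hi : i ∈ s.1
    · simpa [hi] using hB i
    · have : {v | v ∈ B i ↔ i ∈ s.1} = (B i)ᶜ := by ext v; simp [hi]
      rw [this]
      exact (hB i).compl
  have hAb : ∀ s, Bornology.IsBounded (A s) := by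
    rintro ⟨s, i, hi⟩
    exact (hb i).subset fun v hv => (hv i).2 hi
  have hAd : Pairwise fun s t => Disjoint (A s) (A t) := by
    intro s t hst
    refine disjoint_left.2 fun v hs ht => hst (Subtype.ext (Finset.ext fun i => ?_))
    rw [← hs i, ← ht i]
  let g : ({s : Finset ι // s.Nonempty} → ℕ) → ι → ℕ := fun n i =>
    ∑ᶠ (s : {s : Finset ι // s.Nonempty}) (_ : s ∈ {s : {s : Finset ι // s.Nonempty} | i ∈ s.1}),
      n s
  have hg : ∀ c : Config, (fun i => (c.pts ∩ B i).ncard) = g fun s => (c.pts ∩ A s).ncard := by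
    intro c
    funext i
    have : c.pts ∩ B i = ⋃ s ∈ {s : {s : Finset ι // s.Nonempty} | i ∈ s.1}, c.pts ∩ A s := by
      ext v
      simp only [mem_inter_iff, mem_iUnion, mem_ofPred_eq, exists_prop]
      constructor
      · rintro ⟨hv, hvB⟩
        exact ⟨⟨Finset.univ.filter fun j => v ∈ B j, i, by simpa using hvB⟩, by simpa using hvB,
          hv, fun j => by simp⟩
      · rintro ⟨s, hi, hv, hvs⟩
        exact ⟨hv, (hvs i).2 hi⟩
    rw [this, Finite.ncard_biUnion (toFinite _) (fun s _ => c.locFinite _ (hAb s))]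
    exact fun s _ t _ hst => (hAd hst).mono inter_subset_right inter_subset_right
  have key : ∀ {M : Ω → Config}, IsPoissonProcess P M →
      P.map (fun ω i => ((M ω).pts ∩ B i).ncard) =
        (Measure.pi fun s => poissonMeasure (volume (A s)).toNNReal).map g := by
    intro M hM
    have h1 := (iIndepFun_iff_map_fun_eq_pi_map
      fun s => (hM.measurable_count (hA s) (hAb s)).aemeasurable).1 (hM.iIndepFun_count hA hAb hAd)
    simp only [fun s => hM.law_count (A s) (hA s) (hAb s)] at h1
    rw [← h1, Measure.map_map (measurable_of_countable g)
      (measurable_pi_lambda _ fun s => hM.measurable_count (hA s) (hAb s))]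
    congr 1
    funext ω
    exact hg (M ω)
  rw [key hN, key hN']

/-- The law of a Poisson process is determined by its intensity. -/
theorem IsPoissonProcess.map_eq [IsProbabilityMeasure P] (hN : IsPoissonProcess P N)
    (hN' : IsPoissonProcess P N') : P.map N = P.map N' := by
  have := Measure.isProbabilityMeasure_map (μ := P) hN.measurable.aemeasurable
  have := Measure.isProbabilityMeasure_map (μ := P) hN'.measurable.aemeasurable
  refine ext_of_generate_finite countCylinders generateFrom_countCylinders
    isPiSystem_countCylinders ?_ (by simp)
  intro S hS
  have hSm : MeasurableSet S := by
    rw [generateFrom_countCylinders]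
    exact MeasurableSpace.measurableSet_generateFrom hS
  obtain ⟨t, ht, rfl⟩ := hS
  rw [Measure.map_apply hN.measurable hSm, Measure.map_apply hN'.measurable hSm]
  have h := hN.map_count_eq hN' (B := fun b : t => b.1.1) (fun b => (ht b b.2).1)
    fun b => (ht b b.2).2
  have hs : MeasurableSet ({fun b : t => b.1.2} : Set (t → ℕ)) := measurableSet_singleton _
  have h2 := congrArg (fun μ => μ {fun b : t => b.1.2}) h
  rw [Measure.map_apply (measurable_pi_lambda _ fun b =>
      hN.measurable_count (ht b.1 b.2).1 (ht b.1 b.2).2) hs,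
    Measure.map_apply (measurable_pi_lambda _ fun b =>
      hN'.measurable_count (ht b.1 b.2).1 (ht b.1 b.2).2) hs] at h2
  convert h2 using 2 <;>
  · ext ω
    simp [funext_iff]

/-- By stationarity of the Poisson process, the law of a translation invariant function of the
directed forest does not depend on the point from which the forest is seen. -/
theorem IsPoissonProcess.measure_forest_preimage_eq [IsProbabilityMeasure P]
    (hN : IsPoissonProcess P N) (ρ : ℝ) {E : Type*} [MeasurableSpace E]
    {F : Plane → OutGraph → E} (hF : Measurable (F 0)) (hinv : IsTranslationInvariant F)
    (z : Plane) {A : Set E} (hA : MeasurableSet A) :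
    P ((fun ω => F 0 (directedForest ρ (N ω))) ⁻¹' A) =
      P ((fun ω => F z (directedForest ρ (N ω))) ⁻¹' A) := by
  have hm : MeasurableSet ((fun c => F 0 (directedForest ρ c)) ⁻¹' A) :=
    (hF.comp (measurable_directedForest ρ)) hA
  have h := congrArg (fun μ => μ ((fun c => F 0 (directedForest ρ c)) ⁻¹' A))
    (hN.map_eq (hN.translate (-z)))
  rw [Measure.map_apply hN.measurable hm, Measure.map_apply (hN.translate (-z)).measurable hm]
    at h
  have h2 : ∀ ω, F 0 (directedForest ρ ((N ω).translate (-z))) = F z (directedForest ρ (N ω)) := by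
    intro ω
    have := hinv (-z) z (directedForest ρ (N ω))
    rwa [add_neg_cancel, ← directedForest_translate] at this
  have h3 : (fun ω => (N ω).translate (-z)) ⁻¹' ((fun c => F 0 (directedForest ρ c)) ⁻¹' A) =
      (fun ω => F z (directedForest ρ (N ω))) ⁻¹' A := by
    ext ω
    simp only [mem_preimage, h2]
  rw [h3] at h
  exact h

/-! ### Probability estimates -/

/-- The half-open rectangle `[a, b) × [s, t)`. -/
def rect (a b s t : ℝ) : Set Plane :=
  {v | (a ≤ v 0 ∧ v 0 < b) ∧ s ≤ v 1 ∧ v 1 < t}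

theorem rect_eq_preimage (a b s t : ℝ) :
    rect a b s t = WithLp.ofLp ⁻¹' (univ.pi fun i => Ico (![a, s] i) (![b, t] i)) := by
  ext v
  simp [rect, Set.mem_pi, Fin.forall_fin_two]

theorem measurableSet_rect (a b s t : ℝ) : MeasurableSet (rect a b s t) := by
  rw [rect_eq_preimage]
  exact (MeasurableSet.univ_pi fun i => measurableSet_Ico).preimage
    (PiLp.volume_preserving_ofLp (Fin 2)).measurable

theorem volume_rect (a b s t : ℝ) :
    volume (rect a b s t) = ENNReal.ofReal (b - a) * ENNReal.ofReal (t - s) := by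
  rw [rect_eq_preimage, (PiLp.volume_preserving_ofLp (Fin 2)).measure_preimage
    (MeasurableSet.univ_pi fun i => measurableSet_Ico).nullMeasurableSet, Real.volume_pi_Ico]
  simp

theorem isBounded_rect (a b s t : ℝ) : Bornology.IsBounded (rect a b s t) := by
  refine isBounded_iff_forall_norm_le.2 ⟨√((|a| + |b|) ^ 2 + (|s| + |t|) ^ 2), fun v hv => ?_⟩
  rw [EuclideanSpace.norm_eq, Fin.sum_univ_two]
  obtain ⟨⟨h1, h2⟩, h3, h4⟩ := hv
  refine Real.sqrt_le_sqrt ?_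
  gcongr <;>
  · rw [Real.norm_eq_abs, abs_le]
    constructor <;> nlinarith [neg_abs_le a, le_abs_self b, neg_abs_le s, le_abs_self t,
      abs_nonneg a, abs_nonneg b, abs_nonneg s, abs_nonneg t]

theorem toNNReal_volume_rect {a b s t : ℝ} (hab : a ≤ b) (hst : s ≤ t) :
    (((volume (rect a b s t)).toNNReal : NNReal) : ℝ) = (b - a) * (t - s) := by
  rw [volume_rect, ← ENNReal.ofReal_mul (by linarith)]
  exact Real.coe_toNNReal _ (mul_nonneg (by linarith) (by linarith))

theorem IsPoissonProcess.measureReal_count (hN : IsPoissonProcess P N) {B : Set Plane}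
    (hB : MeasurableSet B) (hb : Bornology.IsBounded B) (s : Set ℕ) :
    P.real {ω | ((N ω).pts ∩ B).ncard ∈ s} =
      (poissonMeasure (volume B).toNNReal).real s := by
  rw [← hN.law_count B hB hb, map_measureReal_apply (hN.measurable_count hB hb) (by measurability)]
  rfl

theorem IsPoissonProcess.measureReal_count_eq_zero (hN : IsPoissonProcess P N) {B : Set Plane}
    (hB : MeasurableSet B) (hb : Bornology.IsBounded B) :
    P.real {ω | ((N ω).pts ∩ B).ncard = 0} = Real.exp (-(volume B).toNNReal) := by
  have := hN.measureReal_count hB hb {0}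
  rw [poissonMeasure_real_singleton] at this
  simpa using this

theorem IsPoissonProcess.measureReal_one_le_count (hN : IsPoissonProcess P N) {B : Set Plane}
    (hB : MeasurableSet B) (hb : Bornology.IsBounded B) :
    P.real {ω | 1 ≤ ((N ω).pts ∩ B).ncard} ≤ (volume B).toNNReal := by
  have h := hN.measureReal_count hB hb {0}ᶜ
  rw [probReal_compl_eq_one_sub (measurableSet_singleton 0), poissonMeasure_real_singleton] at h
  have h2 : {ω | ((N ω).pts ∩ B).ncard ∈ ({0} : Set ℕ)ᶜ} = {ω | 1 ≤ ((N ω).pts ∩ B).ncard} := by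
    ext ω
    simp [Nat.one_le_iff_ne_zero]
  rw [← h2, h]
  have := Real.add_one_le_exp (-(((volume B).toNNReal : NNReal) : ℝ))
  simp only [pow_zero, Nat.factorial_zero, Nat.cast_one, mul_one, div_one]
  linarith

theorem IsPoissonProcess.measureReal_two_le_count (hN : IsPoissonProcess P N) {B : Set Plane}
    (hB : MeasurableSet B) (hb : Bornology.IsBounded B) :
    P.real {ω | 2 ≤ ((N ω).pts ∩ B).ncard} ≤ ((volume B).toNNReal : ℝ) ^ 2 := by
  have h := hN.measureReal_count hB hb ({0} ∪ {1})ᶜ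
  rw [probReal_compl_eq_one_sub (by measurability), measureReal_union (by simp) (by measurability),
    poissonMeasure_real_singleton, poissonMeasure_real_singleton] at h
  have h2 : {ω | ((N ω).pts ∩ B).ncard ∈ ({0} ∪ {1} : Set ℕ)ᶜ} =
      {ω | 2 ≤ ((N ω).pts ∩ B).ncard} := by
    ext ω
    simp only [mem_ofPred_eq, mem_compl_iff, mem_union, mem_singleton_iff]
    omega
  rw [← h2, h]
  set l : ℝ := (((volume B).toNNReal : NNReal) : ℝ)
  have hl : 0 ≤ l := NNReal.coe_nonneg _
  have := Real.add_one_le_exp (-l)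
  simp only [pow_zero, Nat.factorial_zero, Nat.cast_one, mul_one, div_one, pow_one,
    Nat.factorial_one]
  nlinarith

theorem IsPoissonProcess.measureReal_one_le_count_inter (hN : IsPoissonProcess P N)
    {B C : Set Plane} (hB : MeasurableSet B) (hb : Bornology.IsBounded B)
    (hC : MeasurableSet C) (hc : Bornology.IsBounded C) (hd : Disjoint B C) :
    P.real {ω | 1 ≤ ((N ω).pts ∩ B).ncard ∧ 1 ≤ ((N ω).pts ∩ C).ncard} ≤
      ((volume B).toNNReal : ℝ) * (volume C).toNNReal := by
  have hind := (hN.iIndepFun_count (A := fun i : Bool => if i then B else C)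
    (by rintro (_ | _) <;> simpa) (by rintro (_ | _) <;> simpa)
    (by rintro (_ | _) (_ | _) h <;> simp_all [disjoint_comm])).indepFun
    (i := true) (j := false) (by simp)
  have h := hind.measure_inter_preimage_eq_mul (Ici 1) (Ici 1) measurableSet_Ici measurableSet_Ici
  have h' := congrArg ENNReal.toReal h
  rw [ENNReal.toReal_mul] at h'
  refine le_trans (le_of_eq h') ?_
  exact mul_le_mul (hN.measureReal_one_le_count hB hb) (hN.measureReal_one_le_count hC hc)
    measureReal_nonneg (NNReal.coe_nonneg _)

/-- The closed box `[a, b] × [-m, m]`. -/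
def box (a b m : ℝ) : Set Plane :=
  {v | (a ≤ v 0 ∧ v 0 ≤ b) ∧ |v 1| ≤ m}

theorem finite_inter_rect (c : Config) (a b s t : ℝ) : (c.pts ∩ rect a b s t).Finite :=
  c.locFinite _ (isBounded_rect a b s t)

theorem one_le_ncard_inter_rect {c : Config} {a b s t : ℝ} {v : Plane} (hv : v ∈ c.pts)
    (hr : v ∈ rect a b s t) : 1 ≤ (c.pts ∩ rect a b s t).ncard :=
  (ncard_pos (finite_inter_rect c a b s t)).2 ⟨v, hv, hr⟩

/-- The event that two distinct points of the configuration in `box a b m` have abscissae at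
distance at most `d`. -/
def closeAbscissae (a b m d : ℝ) : Set Config :=
  {c | ∃ u ∈ c.pts, ∃ w ∈ c.pts, u ≠ w ∧ u ∈ box a b m ∧ w ∈ box a b m ∧ |u 0 - w 0| ≤ d}

/-- The event that two distinct points of the configuration in `box a b m` have ordinates whose
distance differs from `ρ` by at most `d`. -/
def criticalOrdinates (ρ a b m d : ℝ) : Set Config :=
  {c | ∃ u ∈ c.pts, ∃ w ∈ c.pts, u ≠ w ∧ u ∈ box a b m ∧ w ∈ box a b m ∧
    |(|u 1 - w 1|) - ρ| ≤ d}

/-- The event that one of the rectangles `[a, b) × [k η, (k + 1) η)`, `|k| ≤ K`, contains no point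
of the configuration. -/
def emptyRow (a b η : ℝ) (K : ℕ) : Set Config :=
  {c | ∃ k ∈ Finset.Icc (-K : ℤ) K, (c.pts ∩ rect a b (k * η) ((k + 1) * η)).ncard = 0}

/-- Two points with close abscissae lie in one of the overlapping columns of width `2 * d`, each of
which holds two points with probability `O(d ^ 2)`. -/
theorem IsPoissonProcess.measureReal_closeAbscissae_le [IsProbabilityMeasure P]
    (hN : IsPoissonProcess P N) {a b m d : ℝ} (hab : a ≤ b) (hm : 0 ≤ m) (hd : 0 < d) :
    P.real (N ⁻¹' closeAbscissae a b m d) ≤ ((b - a) / d + 1) * (2 * d * (2 * m + 1)) ^ 2 := by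
  set n := ⌊(b - a) / d⌋₊ + 1 with hn
  set R : ℕ → Set Plane := fun k => rect (a + k * d) (a + k * d + 2 * d) (-m) (m + 1) with hR
  have hsub : N ⁻¹' closeAbscissae a b m d ⊆
      ⋃ k ∈ Finset.range n, {ω | 2 ≤ ((N ω).pts ∩ R k).ncard} := by
    have key : ∀ ω, ∀ u ∈ (N ω).pts, ∀ w ∈ (N ω).pts, u ≠ w → u ∈ box a b m → w ∈ box a b m →
        |u 0 - w 0| ≤ d → u 0 ≤ w 0 →
        ω ∈ ⋃ k ∈ Finset.range n, {ω | 2 ≤ ((N ω).pts ∩ R k).ncard} := by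
      intro ω u hu w hw hne hub hwb hd' hle
      obtain ⟨⟨h1, h2⟩, h3⟩ := hub
      obtain ⟨⟨h4, h5⟩, h6⟩ := hwb
      rw [abs_le] at h3 h6 hd'
      have h0 : 0 ≤ (u 0 - a) / d := div_nonneg (by linarith) hd.le
      have hk1 := Nat.floor_le h0
      have hk2 := Nat.lt_floor_add_one ((u 0 - a) / d)
      rw [le_div_iff₀ hd] at hk1
      rw [div_lt_iff₀ hd] at hk2
      have hkn : ⌊(u 0 - a) / d⌋₊ < n := by
        rw [hn, Nat.lt_succ_iff]
        exact Nat.floor_le_floor (by gcongr)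
      simp only [mem_iUnion, Finset.mem_range]
      refine ⟨⌊(u 0 - a) / d⌋₊, hkn, ?_⟩
      have hsub : {u, w} ⊆ (N ω).pts ∩ R ⌊(u 0 - a) / d⌋₊ := by
        rintro v (rfl | rfl)
        · exact ⟨hu, ⟨by linarith, by linarith⟩, by linarith, by linarith⟩
        · exact ⟨hw, ⟨by linarith, by linarith⟩, by linarith, by linarith⟩
      have := ncard_le_ncard hsub (finite_inter_rect _ _ _ _ _)
      rwa [ncard_pair hne] at this
    rintro ω ⟨u, hu, w, hw, hne, hub, hwb, hd'⟩
    rcases le_total (u 0) (w 0) with h | h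
    · exact key ω u hu w hw hne hub hwb hd' h
    · exact key ω w hw u hu hne.symm hwb hub (by rwa [abs_sub_comm]) h
  calc P.real (N ⁻¹' closeAbscissae a b m d)
      ≤ P.real (⋃ k ∈ Finset.range n, {ω | 2 ≤ ((N ω).pts ∩ R k).ncard}) := measureReal_mono hsub (measure_ne_top _ _)
    _ ≤ ∑ k ∈ Finset.range n, P.real {ω | 2 ≤ ((N ω).pts ∩ R k).ncard} :=
        measureReal_biUnion_finset_le _ _
    _ ≤ ∑ _k ∈ Finset.range n, (2 * d * (2 * m + 1)) ^ 2 := by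
        refine Finset.sum_le_sum fun k _ => ?_
        have := hN.measureReal_two_le_count (measurableSet_rect _ _ _ _) (isBounded_rect
          (a + k * d) (a + k * d + 2 * d) (-m) (m + 1))
        rw [toNNReal_volume_rect (by linarith) (by linarith)] at this
        refine this.trans (le_of_eq ?_)
        ring
    _ = n * (2 * d * (2 * m + 1)) ^ 2 := by simp
    _ ≤ _ := by
        gcongr
        rw [hn]
        push_cast
        gcongr
        exact Nat.floor_le (div_nonneg (by linarith) hd.le)

/-- A pair of points whose ordinates differ by nearly `ρ` has its lower point in a row of height
`d` and its upper point in a row of height `4 * d` disjoint from the first one. -/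
theorem IsPoissonProcess.measureReal_criticalOrdinates_le [IsProbabilityMeasure P]
    (hN : IsPoissonProcess P N) {ρ a b m d : ℝ} (hab : a ≤ b) (hm : 0 ≤ m) (hd : 0 < d)
    (hρ : 2 * d ≤ ρ) :
    P.real (N ⁻¹' criticalOrdinates ρ a b m d) ≤
      (2 * m / d + 1) * (((b - a + 1) * d) * ((b - a + 1) * (4 * d))) := by
  set n := ⌊2 * m / d⌋₊ + 1 with hn
  set R : ℕ → Set Plane := fun k => rect a (b + 1) (-m + k * d) (-m + k * d + d) with hR
  set R' : ℕ → Set Plane := fun k =>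
    rect a (b + 1) (-m + k * d + ρ - d) (-m + k * d + ρ + 3 * d) with hR'
  have hsub : N ⁻¹' criticalOrdinates ρ a b m d ⊆ ⋃ k ∈ Finset.range n,
      {ω | 1 ≤ ((N ω).pts ∩ R k).ncard ∧ 1 ≤ ((N ω).pts ∩ R' k).ncard} := by
    have key : ∀ ω, ∀ u ∈ (N ω).pts, ∀ w ∈ (N ω).pts, u ∈ box a b m → w ∈ box a b m →
        |(|u 1 - w 1|) - ρ| ≤ d → u 1 ≤ w 1 → ω ∈ ⋃ k ∈ Finset.range n,
          {ω | 1 ≤ ((N ω).pts ∩ R k).ncard ∧ 1 ≤ ((N ω).pts ∩ R' k).ncard} := by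
      intro ω u hu w hw hub hwb hd' hle
      obtain ⟨⟨h1, h2⟩, h3⟩ := hub
      obtain ⟨⟨h4, h5⟩, h6⟩ := hwb
      rw [abs_of_nonpos (show u 1 - w 1 ≤ 0 by linarith), abs_le] at hd'
      rw [abs_le] at h3 h6
      have h0 : 0 ≤ (u 1 + m) / d := div_nonneg (by linarith) hd.le
      have hk1 := Nat.floor_le h0
      have hk2 := Nat.lt_floor_add_one ((u 1 + m) / d)
      rw [le_div_iff₀ hd] at hk1
      rw [div_lt_iff₀ hd] at hk2
      have hkn : ⌊(u 1 + m) / d⌋₊ < n := by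
        rw [hn, Nat.lt_succ_iff]
        refine Nat.floor_le_floor ?_
        gcongr
        linarith
      simp only [mem_iUnion, Finset.mem_range]
      refine ⟨⌊(u 1 + m) / d⌋₊, hkn, ?_, ?_⟩
      · exact one_le_ncard_inter_rect hu
          ⟨⟨by linarith, by linarith⟩, by linarith, by linarith⟩
      · exact one_le_ncard_inter_rect hw
          ⟨⟨by linarith, by linarith⟩, by linarith, by linarith⟩
    rintro ω ⟨u, hu, w, hw, hne, hub, hwb, hd'⟩
    rcases le_total (u 1) (w 1) with h | h
    · exact key ω u hu w hw hub hwb hd' h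
    · exact key ω w hw u hu hwb hub (by rwa [abs_sub_comm (w 1)]) h
  calc P.real (N ⁻¹' criticalOrdinates ρ a b m d)
      ≤ P.real (⋃ k ∈ Finset.range n,
          {ω | 1 ≤ ((N ω).pts ∩ R k).ncard ∧ 1 ≤ ((N ω).pts ∩ R' k).ncard}) :=
        measureReal_mono hsub (measure_ne_top _ _)
    _ ≤ ∑ k ∈ Finset.range n,
          P.real {ω | 1 ≤ ((N ω).pts ∩ R k).ncard ∧ 1 ≤ ((N ω).pts ∩ R' k).ncard} :=
        measureReal_biUnion_finset_le _ _
    _ ≤ ∑ _k ∈ Finset.range n, ((b - a + 1) * d) * ((b - a + 1) * (4 * d)) := by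
        refine Finset.sum_le_sum fun k _ => ?_
        have hdisj : Disjoint (R k) (R' k) := by
          refine disjoint_left.2 fun v hv hv' => ?_
          have h1 := hv.2.2
          have h2 := hv'.2.1
          linarith
        have := hN.measureReal_one_le_count_inter (measurableSet_rect _ _ _ _)
          (isBounded_rect _ _ _ _) (measurableSet_rect _ _ _ _) (isBounded_rect _ _ _ _) hdisj
        rw [toNNReal_volume_rect (by linarith) (by linarith),
          toNNReal_volume_rect (by linarith) (by linarith)] at this
        refine this.trans (le_of_eq ?_)
        ring
    _ = n * (((b - a + 1) * d) * ((b - a + 1) * (4 * d))) := by simp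
    _ ≤ _ := by
        have : 0 ≤ b - a := by linarith
        gcongr
        rw [hn]
        push_cast
        gcongr
        exact Nat.floor_le (by positivity)

theorem IsPoissonProcess.measureReal_emptyRow_le [IsProbabilityMeasure P]
    (hN : IsPoissonProcess P N) {a b η : ℝ} (hab : a ≤ b) (hη : 0 ≤ η) (K : ℕ) :
    P.real (N ⁻¹' emptyRow a b η K) ≤ (2 * K + 1) * Real.exp (-((b - a) * η)) := by
  have hsub : N ⁻¹' emptyRow a b η K ⊆ ⋃ k ∈ Finset.Icc (-K : ℤ) K,
      {ω | ((N ω).pts ∩ rect a b (k * η) ((k + 1) * η)).ncard = 0} := by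
    rintro ω ⟨k, hk, h⟩
    simp only [mem_iUnion]
    exact ⟨k, hk, h⟩
  calc P.real (N ⁻¹' emptyRow a b η K)
      ≤ _ := measureReal_mono hsub (measure_ne_top _ _)
    _ ≤ ∑ k ∈ Finset.Icc (-K : ℤ) K,
          P.real {ω | ((N ω).pts ∩ rect a b (k * η) ((k + 1) * η)).ncard = 0} :=
        measureReal_biUnion_finset_le _ _
    _ = ∑ _k ∈ Finset.Icc (-K : ℤ) K, Real.exp (-((b - a) * η)) := by
        refine Finset.sum_congr rfl fun k _ => ?_
        rw [hN.measureReal_count_eq_zero (measurableSet_rect _ _ _ _) (isBounded_rect _ _ _ _),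
          toNNReal_volume_rect hab (by linarith)]
        ring_nf
    _ = _ := by
        rw [Finset.sum_const, Int.card_Icc, nsmul_eq_mul]
        congr 1
        rw [show ((K : ℤ) + 1 - -K).toNat = 2 * K + 1 by omega]
        push_cast
        ring

/-! ### Comparison of the ancestors in the tree and in the forest -/

theorem norm_sq_eq_coord (v : Plane) : ‖v‖ ^ 2 = v 0 ^ 2 + v 1 ^ 2 := by
  rw [EuclideanSpace.real_norm_sq_eq, Fin.sum_univ_two]

theorem abs_coord_le_norm (v : Plane) (i : Fin 2) : |v i| ≤ ‖v‖ :=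
  PiLp.norm_apply_le v i

theorem norm_le_abs_add_abs (v : Plane) : ‖v‖ ≤ |v 0| + |v 1| := by
  refine abs_le_of_sq_le_sq' ?_ (by positivity) |>.2
  rw [norm_sq_eq_coord, ← sq_abs (v 0), ← sq_abs (v 1)]
  nlinarith [abs_nonneg (v 0), abs_nonneg (v 1)]

theorem mem_cyl_iff {ρ : ℝ} {v w : Plane} :
    w ∈ cyl ρ v ↔ (∃ t : ℝ, 0 ≤ t ∧ t ≤ 1 ∧ ‖w - t • v‖ < ρ) ∧ ‖w‖ < ‖v‖ := by
  simp only [cyl, segment_eq_image, mem_inter_iff, Set.mem_add, mem_image, mem_Icc,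
    Metric.mem_ball, dist_zero_right, smul_zero, zero_add]
  refine and_congr_left fun _ => ?_
  constructor
  · rintro ⟨_, ⟨t, ⟨h0, h1⟩, rfl⟩, e, he, rfl⟩
    exact ⟨t, h0, h1, by simpa using he⟩
  · rintro ⟨t, h0, h1, he⟩
    exact ⟨_, ⟨t, ⟨h0, h1⟩, rfl⟩, _, he, by simp⟩

/-- Far from the origin and in a bounded horizontal strip, the norm orders points as the abscissa
does, up to an error of order `1 / r` on the abscissae. -/
theorem norm_lt_norm_of_add_lt {r h m b : ℝ} {z y : Plane} (hr : 0 < r) (hh : h ≤ r / 2)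
    (hz : z ∈ box (r - h) b m) (hy : y ∈ box (r - h) b m) (hzy : z 0 + m ^ 2 / r < y 0) :
    ‖z‖ < ‖y‖ := by
  refine lt_of_pow_lt_pow_left₀ 2 (norm_nonneg _) ?_
  rw [norm_sq_eq_coord, norm_sq_eq_coord]
  have h1 : z 1 ^ 2 ≤ m ^ 2 := by rw [← sq_abs]; gcongr; exact hz.2
  have h2 := sq_nonneg (y 1)
  have h3 : m ^ 2 / r * r = m ^ 2 := by field_simp
  have h4 : r ≤ y 0 + z 0 := by linarith [hz.1.1, hy.1.1]
  have h5 : 0 < y 0 - z 0 := by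
    have : 0 ≤ m ^ 2 / r := by positivity
    linarith
  nlinarith [mul_lt_mul_of_pos_right (show m ^ 2 / r < y 0 - z 0 by linarith) hr,
    mul_le_mul_of_nonneg_left h4 h5.le]

/-- The scales of the comparison at distance `r` from the origin: the local window has radius `L`,
the configuration is inspected in `box (r - h) (r + m) m`, and `h` is large but small with respect
to `r`. -/
structure Scales (L ρ m h r : ℝ) : Prop where
  L_pos : 0 < L
  ρ_pos : 0 < ρ
  m_eq : m = 2 * (L + ρ) + 1
  m_le : 8 * m ≤ h
  h_le : 4 * h ≤ r
  small : 4 * m * h / r ≤ ρ / 4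

section Comparison

variable {L ρ m h r : ℝ} {v w : Plane}

theorem coord_bounds_of_mem_ball (hv : v ∈ Metric.ball (!₂[r, 0] : Plane) L) :
    |v 0 - r| < L ∧ |v 1| < L := by
  rw [Metric.mem_ball, dist_eq_norm] at hv
  have h0 := (abs_coord_le_norm (v - !₂[r, 0]) 0).trans_lt hv
  have h1 := (abs_coord_le_norm (v - !₂[r, 0]) 1).trans_lt hv
  simp only [PiLp.sub_apply] at h0 h1
  exact ⟨by simpa using h0, by simpa using h1⟩

theorem Scales.mem_cyl (S : Scales L ρ m h r) (hv : v ∈ Metric.ball (!₂[r, 0] : Plane) L)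
    (hw : w ∈ box (r - h) (r + m) m) (hle : w 0 ≤ v 0) (hnorm : ‖w‖ < ‖v‖)
    (hd : |w 1 - v 1| < ρ - 4 * m * h / r) : w ∈ cyl ρ v := by
  obtain ⟨hL, hρ, hm, hmh, hhr, -⟩ := S
  obtain ⟨hv0, hv1⟩ := coord_bounds_of_mem_ball hv
  rw [abs_lt] at hv0
  have hr : 0 < r := by linarith
  have hv0' : r / 2 ≤ v 0 := by linarith
  have hv0p : 0 < v 0 := by linarith
  have hw0 := hw.1.1
  -- `w` is compared with the point of the segment that has the same abscissa.
  refine mem_cyl_iff.2 ⟨⟨w 0 / v 0, div_nonneg (by linarith) hv0p.le,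
    div_le_one_of_le₀ hle hv0p.le, ?_⟩, hnorm⟩
  have h0 : (w - (w 0 / v 0) • v) 0 = 0 := by
    simp only [PiLp.sub_apply, PiLp.smul_apply, smul_eq_mul]
    field_simp
    ring
  have h1 : (w - (w 0 / v 0) • v) 1 = (w 1 - v 1) + (1 - w 0 / v 0) * v 1 := by
    simp only [PiLp.sub_apply, PiLp.smul_apply, smul_eq_mul]
    ring
  have ht : |1 - w 0 / v 0| ≤ 4 * h / r := by
    rw [show 1 - w 0 / v 0 = (v 0 - w 0) / v 0 by field_simp,
      abs_of_nonneg (div_nonneg (by linarith) hv0p.le), div_le_div_iff₀ hv0p hr]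
    nlinarith
  calc ‖w - (w 0 / v 0) • v‖ ≤ _ := norm_le_abs_add_abs _
    _ ≤ |w 1 - v 1| + |(1 - w 0 / v 0) * v 1| := by
        rw [h0, h1, abs_zero, zero_add]
        exact abs_add_le _ _
    _ ≤ |w 1 - v 1| + 4 * h / r * m := by
        rw [abs_mul]
        have : 0 ≤ 4 * h / r := div_nonneg (by linarith) hr.le
        gcongr
        linarith
    _ < ρ := by
        rw [show 4 * h / r * m = 4 * m * h / r by ring]
        linarith

theorem Scales.abs_sub_lt_of_mem_cyl (S : Scales L ρ m h r)
    (hv : v ∈ Metric.ball (!₂[r, 0] : Plane) L) (hw : w ∈ cyl ρ v) (hw0 : r - h ≤ w 0) :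
    |w 1 - v 1| < ρ + 4 * m * h / r := by
  obtain ⟨hL, hρ, hm, hmh, hhr, -⟩ := S
  obtain ⟨hv0, hv1⟩ := coord_bounds_of_mem_ball hv
  rw [abs_lt] at hv0
  have hr : 0 < r := by linarith
  obtain ⟨⟨t, ht0, ht1, he⟩, -⟩ := mem_cyl_iff.1 hw
  have h0 := (abs_coord_le_norm (w - t • v) 0).trans_lt he
  have h1 := (abs_coord_le_norm (w - t • v) 1).trans_lt he
  simp only [PiLp.sub_apply, PiLp.smul_apply, smul_eq_mul] at h0 h1
  rw [abs_lt] at h0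
  have ht : 1 - t ≤ 4 * h / r := by
    rw [le_div_iff₀ hr]
    nlinarith
  calc |w 1 - v 1| = |(w 1 - t * v 1) + -((1 - t) * v 1)| := by ring_nf
    _ ≤ |w 1 - t * v 1| + (1 - t) * |v 1| := by
        refine (abs_add_le _ _).trans ?_
        rw [abs_neg, abs_mul, abs_of_nonneg (show 0 ≤ 1 - t by linarith)]
    _ ≤ |w 1 - t * v 1| + 4 * h / r * m := by
        have : 0 ≤ 4 * h / r := div_nonneg (by linarith) hr.le
        gcongr
        linarith
    _ < _ := by
        rw [show 4 * h / r * m = 4 * m * h / r by ring]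
        linarith

theorem Scales.bounds_of_mem_cyl (S : Scales L ρ m h r)
    (hv : v ∈ Metric.ball (!₂[r, 0] : Plane) L) (hw : w ∈ cyl ρ v) :
    -ρ < w 0 ∧ w 0 ≤ r + m ∧ |w 1| ≤ m := by
  obtain ⟨hL, hρ, hm, hmh, hhr, -⟩ := S
  obtain ⟨hv0, hv1⟩ := coord_bounds_of_mem_ball hv
  rw [abs_lt] at hv0 hv1
  obtain ⟨⟨t, ht0, ht1, he⟩, -⟩ := mem_cyl_iff.1 hw
  have h0 := (abs_coord_le_norm (w - t • v) 0).trans_lt he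
  have h1 := (abs_coord_le_norm (w - t • v) 1).trans_lt he
  simp only [PiLp.sub_apply, PiLp.smul_apply, smul_eq_mul] at h0 h1
  rw [abs_lt] at h0 h1
  have hv0p : 0 < v 0 := by linarith
  have h2 : 0 ≤ t * v 0 := by positivity
  have h3 : t * v 0 ≤ v 0 := mul_le_of_le_one_left hv0p.le ht1
  refine ⟨by linarith, by linarith, abs_le.2 ⟨?_, ?_⟩⟩ <;> nlinarith

/-- Outside three unlikely events, a vertex close to `(r, 0)` has the same ancestor in the radial
tree and in the directed forest. -/
theorem Scales.anc_eq (S : Scales L ρ m h r) {c : Config}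
    (h₁ : c ∉ closeAbscissae (r - h) (r + m) m (m ^ 2 / r))
    (h₂ : c ∉ criticalOrdinates ρ (r - h) (r + m) m (4 * m * h / r))
    (h₃ : c ∉ emptyRow (r - h / 2) (r - h / 4) (ρ / 2) (⌈L / (ρ / 2)⌉₊ + 1))
    (hvc : v ∈ c.pts) (hv : v ∈ Metric.ball (!₂[r, 0] : Plane) L) :
    (radialPoissonTree ρ c).anc v = (directedForest ρ c).anc v := by
  classical
  have S' := S
  obtain ⟨hL, hρ, hm, hmh, hhr, hsm⟩ := S'
  have hr : 0 < r := by linarith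
  obtain ⟨hv0, hv1⟩ := coord_bounds_of_mem_ball hv
  rw [abs_lt] at hv0
  have hd0 : 0 ≤ m ^ 2 / r := by positivity
  have he0 : 0 ≤ 4 * m * h / r := div_nonneg (by nlinarith) hr.le
  have hvbox : v ∈ box (r - h) (r + m) m := ⟨⟨by linarith, by linarith⟩, by linarith⟩
  have hA : ∀ u ∈ c.pts, ∀ w ∈ c.pts, u ≠ w → u ∈ box (r - h) (r + m) m →
      w ∈ box (r - h) (r + m) m → m ^ 2 / r < |u 0 - w 0| := by
    intro u hu w hw hne hub hwb
    by_contra! hcon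
    exact h₁ ⟨u, hu, w, hw, hne, hub, hwb, hcon⟩
  -- In the box, the norm and the abscissa order the points in the same way.
  have hord : ∀ u ∈ c.pts, ∀ w ∈ c.pts, u ∈ box (r - h) (r + m) m →
      w ∈ box (r - h) (r + m) m → u 0 < w 0 → ‖u‖ < ‖w‖ := by
    intro u hu w hw hub hwb hlt
    have := hA u hu w hw (fun h => by rw [h] at hlt; exact lt_irrefl _ hlt) hub hwb
    rw [abs_of_neg (by linarith)] at this
    exact norm_lt_norm_of_add_lt hr (by linarith) hub hwb (by linarith)
  -- In the box, the cylinder and the half-strip contain the same points.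
  have hiff : ∀ w ∈ c.pts, w ≠ v → w ∈ box (r - h) (r + m) m →
      (w ∈ cyl ρ v ↔ w ∈ halfStrip ρ v) := by
    intro w hw hne hwb
    have hB : 4 * m * h / r < |(|w 1 - v 1|) - ρ| := by
      by_contra! hcon
      exact h₂ ⟨w, hw, v, hvc, hne, hwb, hvbox, hcon⟩
    have hA' := hA w hw v hvc hne hwb hvbox
    constructor
    · intro hcyl
      refine ⟨?_, ?_⟩
      · by_contra! hlt
        exact lt_asymm (hord v hvc w hw hvbox hwb hlt) (mem_cyl_iff.1 hcyl).2
      · by_contra! hlt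
        rw [abs_of_pos (by linarith)] at hB
        linarith [S.abs_sub_lt_of_mem_cyl hv hcyl hwb.1.1]
    · rintro ⟨hle, habs⟩
      have hlt : w 0 < v 0 := by
        refine lt_of_le_of_ne hle fun heq => ?_
        rw [heq, sub_self, abs_zero] at hA'
        linarith
      rw [abs_of_nonpos (by linarith)] at hB
      exact S.mem_cyl hv hwb hle (hord w hw v hvc hwb hvbox hlt) (by linarith)
  -- The row of `v` contains a point of the half-strip.
  obtain ⟨x, hxc, hx0, hx0', hx1⟩ : ∃ x ∈ c.pts, r - h / 2 ≤ x 0 ∧ x 0 < r - h / 4 ∧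
      |x 1 - v 1| < ρ / 2 := by
    have hη : 0 < ρ / 2 := by linarith
    set k := ⌊v 1 / (ρ / 2)⌋ with hk
    have hk1 := Int.floor_le (v 1 / (ρ / 2))
    have hk2 := Int.lt_floor_add_one (v 1 / (ρ / 2))
    rw [← hk] at hk1 hk2
    rw [abs_lt] at hv1
    have hK := Nat.le_ceil (L / (ρ / 2))
    have hv1a : v 1 / (ρ / 2) < L / (ρ / 2) := by gcongr; exact hv1.2
    have hv1b : -(L / (ρ / 2)) < v 1 / (ρ / 2) := by rw [← neg_div]; gcongr; exact hv1.1
    have hkK : k ∈ Finset.Icc (-(⌈L / (ρ / 2)⌉₊ + 1 : ℕ) : ℤ) (⌈L / (ρ / 2)⌉₊ + 1 : ℕ) := by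
      rw [Finset.mem_Icc]
      constructor
      · have : (-(⌈L / (ρ / 2)⌉₊ + 1 : ℕ) : ℝ) ≤ k := by push_cast; linarith
        exact_mod_cast this
      · have : (k : ℝ) ≤ (⌈L / (ρ / 2)⌉₊ + 1 : ℕ) := by push_cast; linarith
        exact_mod_cast this
    have hne : (c.pts ∩ rect (r - h / 2) (r - h / 4) (k * (ρ / 2))
        ((k + 1) * (ρ / 2))).ncard ≠ 0 := fun h0 => h₃ ⟨k, hkK, h0⟩
    obtain ⟨x, hxc, ⟨hx0, hx0'⟩, hx1, hx1'⟩ := nonempty_of_ncard_ne_zero hne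
    rw [le_div_iff₀ hη] at hk1
    rw [div_lt_iff₀ hη] at hk2
    exact ⟨x, hxc, hx0, hx0', abs_lt.2 ⟨by linarith, by linarith⟩⟩
  rw [abs_lt] at hx1 hv1
  set T : Set Plane := {w | w ∈ c.pts ∧ w ≠ v ∧ w ∈ halfStrip ρ v ∧ w ∈ box (r - h) (r + m) m}
    with hT
  have hxT : x ∈ T := by
    refine ⟨hxc, fun hxv => ?_, ⟨by linarith, abs_le.2 ⟨by linarith, by linarith⟩⟩,
      ⟨by linarith, by linarith⟩, abs_le.2 ⟨by linarith, by linarith⟩⟩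
    rw [hxv] at hx0'
    linarith
  have hTfin : T.Finite := by
    refine (finite_inter_rect c (r - h) (r + m + 1) (-m) (m + 1)).subset ?_
    rintro w ⟨hw, -, -, ⟨h1, h2⟩, h3⟩
    rw [abs_le] at h3
    exact ⟨hw, ⟨h1, by linarith⟩, by linarith, by linarith⟩
  obtain ⟨y, hyT, hymax⟩ := exists_max_image T (fun w => w 0) hTfin ⟨x, hxT⟩
  obtain ⟨hyc, hyv, hys, hyb⟩ := hyT
  have hxy : x 0 ≤ y 0 := hymax x hxT
  have hyn : r - h / 2 ≤ ‖y‖ := by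
    have := (le_abs_self _).trans (abs_coord_le_norm y 0)
    linarith
  have hlt : ∀ z ∈ T, z ≠ y → z 0 < y 0 := by
    intro z hz hzy
    refine lt_of_le_of_ne (hymax z hz) fun heq => ?_
    have := hA z hz.1 y hyc hzy hz.2.2.2 hyb
    rw [heq, sub_self, abs_zero] at this
    linarith
  have hball : ∀ w : Plane, ρ ≤ ‖w‖ → w ∉ Metric.ball (0 : Plane) ρ := by
    intro w hw hwb
    rw [mem_ball_zero_iff] at hwb
    linarith
  have hforest : (directedForest ρ c).anc v = some y := by
    refine directedForest_anc_eq_some_iff.2 ⟨hvc, ⟨⟨hyc, hyv⟩, hys⟩, ?_⟩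
    rintro z ⟨⟨hz, hzv⟩, hzs⟩ hzy
    by_cases hz0 : r - h ≤ z 0
    · have habs := abs_le.1 hzs.2
      have hz0' := hzs.1
      exact hlt z ⟨hz, hzv, hzs, ⟨hz0, by linarith⟩, abs_le.2 ⟨by linarith, by linarith⟩⟩ hzy
    · push Not at hz0
      linarith
  have htree : argmax (fun Y => ‖Y‖) (cyl ρ v ∩ (c.pts \ Metric.ball 0 ρ)) = some y := by
    refine argmax_eq_some_iff.2
      ⟨⟨(hiff y hyc hyv hyb).2 hys, hyc, hball y (by linarith)⟩, ?_⟩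
    rintro z ⟨hzcyl, hz, -⟩ hzy
    have hzv : z ≠ v := fun h => lt_irrefl _ (h ▸ (mem_cyl_iff.1 hzcyl).2)
    obtain ⟨hza, hzb, hz1⟩ := S.bounds_of_mem_cyl hv hzcyl
    by_cases hz0 : r - h ≤ z 0
    · have hzbox : z ∈ box (r - h) (r + m) m := ⟨⟨hz0, hzb⟩, hz1⟩
      exact hord z hz y hyc hzbox hyb
        (hlt z ⟨hz, hzv, (hiff z hz hzv hzbox).1 hzcyl, hzbox⟩ hzy)
    · push Not at hz0
      have : |z 0| < r - h := abs_lt.2 ⟨by linarith, hz0⟩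
      have := norm_le_abs_add_abs z
      linarith
  have hvmem : v ∈ c.pts \ Metric.ball (0 : Plane) ρ := by
    refine ⟨hvc, hball v ?_⟩
    have := (le_abs_self _).trans (abs_coord_le_norm v 0)
    linarith
  rw [hforest]
  simp only [radialPoissonTree, if_pos hvmem, htree, Option.getD_some]

end Comparison

/-! ### The rate of convergence -/

/-- The coupling inequality. No measurability is needed, `P` being applied to arbitrary sets as an
outer measure. -/
theorem abs_measureReal_preimage_sub_le [IsFiniteMeasure P] {E : Type*} {f g : Ω → E} {D : Set Ω}
    (h : ∀ ω ∉ D, f ω = g ω) (A : Set E) :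
    |P.real (f ⁻¹' A) - P.real (g ⁻¹' A)| ≤ P.real D := by
  have key : ∀ {f g : Ω → E}, (∀ ω ∉ D, f ω = g ω) →
      P.real (f ⁻¹' A) ≤ P.real (g ⁻¹' A) + P.real D := by
    intro f g h
    refine (measureReal_mono (fun ω hω => ?_) (measure_ne_top _ _)).trans
      (measureReal_union_le _ _)
    by_cases hD : ω ∈ D
    · exact Or.inr hD
    · left
      rw [mem_preimage, ← h ω hD]
      exact hω
  rw [abs_le]
  constructor
  · linarith [key fun ω hω => (h ω hω).symm]
  · linarith [key h]

theorem tvDistLaw_nonneg {E : Type*} [MeasurableSpace E] (P : Measure Ω) (f g : Ω → E) :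
    0 ≤ tvDistLaw P f g :=
  Real.iSup_nonneg fun _ => abs_nonneg _

theorem Scales.apply_tree_eq_apply_forest {L ρ m h r : ℝ} (S : Scales L ρ m h r) {c : Config}
    (h₁ : c ∉ closeAbscissae (r - h) (r + m) m (m ^ 2 / r))
    (h₂ : c ∉ criticalOrdinates ρ (r - h) (r + m) m (4 * m * h / r))
    (h₃ : c ∉ emptyRow (r - h / 2) (r - h / 4) (ρ / 2) (⌈L / (ρ / 2)⌉₊ + 1))
    {E : Type*} {F : Plane → OutGraph → E}
    (hF : ∀ (X : Plane) (G G' : OutGraph), (symmDiff G.verts G'.verts).Finite →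
      G.verts ∩ Metric.ball X L = G'.verts ∩ Metric.ball X L →
      (∀ v ∈ G.verts ∩ Metric.ball X L, G.anc v = G'.anc v) → F X G = F X G') :
    F !₂[r, 0] (radialPoissonTree ρ c) = F !₂[r, 0] (directedForest ρ c) := by
  have hverts : (radialPoissonTree ρ c).verts ∩ Metric.ball !₂[r, 0] L =
      (directedForest ρ c).verts ∩ Metric.ball !₂[r, 0] L := by
    ext v
    simp only [mem_inter_iff]
    refine and_congr_left fun hv => ?_
    obtain ⟨hv0, -⟩ := coord_bounds_of_mem_ball hv
    rw [abs_lt] at hv0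
    obtain ⟨hL, hρ, hm, hmh, hhr, -⟩ := S
    have hn := (le_abs_self _).trans (abs_coord_le_norm v 0)
    simp only [radialPoissonTree, directedForest, mem_insert_iff, Set.mem_sdiff,
      mem_ball_zero_iff, not_lt]
    constructor
    · rintro (rfl | h)
      · simp only [norm_zero] at hn
        linarith
      · exact h.1
    · exact fun h => Or.inr ⟨h, by linarith⟩
  refine hF _ _ _ ?_ hverts fun v hv => ?_
  · refine ((c.locFinite _ (Metric.isBounded_ball (x := 0) (r := ρ))).insert 0).subset ?_
    rintro v (⟨rfl | h, hn⟩ | ⟨h, hn⟩)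
    · exact Or.inl rfl
    · exact absurd h.1 hn
    · refine Or.inr ⟨h, ?_⟩
      by_contra hb
      exact hn (Or.inr ⟨h, hb⟩)
  · have hv' := hv
    rw [hverts] at hv'
    exact S.anc_eq h₁ h₂ h₃ hv'.1 hv.2

/-- The three events on which the tree and the forest may differ have total probability
`O(h ^ 3 / r) + O(exp (-h * ρ / 8))`. -/
theorem Scales.tvDistLaw_le [IsProbabilityMeasure P] (hN : IsPoissonProcess P N)
    {L ρ m h r : ℝ} (S : Scales L ρ m h r) (hr : m ^ 2 ≤ r) (hsm : 4 * m * h / r ≤ 1)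
    {E : Type*} [MeasurableSpace E] {F : Plane → OutGraph → E} (hFmeas : Measurable (F 0))
    (hF : ∀ (X : Plane) (G G' : OutGraph), (symmDiff G.verts G'.verts).Finite →
      G.verts ∩ Metric.ball X L = G'.verts ∩ Metric.ball X L →
      (∀ v ∈ G.verts ∩ Metric.ball X L, G.anc v = G'.anc v) → F X G = F X G')
    (hFinv : IsTranslationInvariant F) :
    tvDistLaw P (fun ω => F !₂[r, 0] (radialPoissonTree ρ (N ω)))
        (fun ω => F 0 (directedForest ρ (N ω))) ≤
      (12 * (2 * m + 1) ^ 2 * m ^ 2 + 144 * (2 * m + 1) * m) * (h ^ 3 / r) +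
        (2 * (⌈L / (ρ / 2)⌉₊ + 1 : ℕ) + 1) * Real.exp (-(ρ / 8) * h) := by
  have S' := S
  obtain ⟨hL, hρ, hm, hmh, hhr, hsm'⟩ := S'
  have hm1 : 1 ≤ m := by linarith
  have hh : 1 ≤ h := by linarith
  have hr0 : 0 < r := by linarith
  set K := ⌈L / (ρ / 2)⌉₊ + 1 with hK
  set D₁ := closeAbscissae (r - h) (r + m) m (m ^ 2 / r) with hD₁
  set D₂ := criticalOrdinates ρ (r - h) (r + m) m (4 * m * h / r) with hD₂
  set D₃ := emptyRow (r - h / 2) (r - h / 4) (ρ / 2) K with hD₃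
  have b₁ : P.real (N ⁻¹' D₁) ≤ 12 * (2 * m + 1) ^ 2 * m ^ 2 * (h ^ 3 / r) := by
    have hd : 0 < m ^ 2 / r := by positivity
    have hd1 : m ^ 2 / r ≤ 1 := (div_le_one hr0).2 hr
    refine (hN.measureReal_closeAbscissae_le (by linarith) (by linarith) hd).trans ?_
    calc ((r + m - (r - h)) / (m ^ 2 / r) + 1) * (2 * (m ^ 2 / r) * (2 * m + 1)) ^ 2
        = 4 * (2 * m + 1) ^ 2 * (m ^ 2 / r) * (m + h + m ^ 2 / r) := by
          field_simp
          ring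
      _ ≤ 4 * (2 * m + 1) ^ 2 * (m ^ 2 / r) * (3 * h) := by
          gcongr
          linarith
      _ ≤ 4 * (2 * m + 1) ^ 2 * (m ^ 2 / r) * (3 * h ^ 3) := by
          gcongr
          exact le_self_pow₀ hh (by norm_num)
      _ = _ := by ring
  have b₂ : P.real (N ⁻¹' D₂) ≤ 144 * (2 * m + 1) * m * (h ^ 3 / r) := by
    have hd : 0 < 4 * m * h / r := by positivity
    refine (hN.measureReal_criticalOrdinates_le (by linarith) (by linarith) hd
      (by linarith)).trans ?_
    set d := 4 * m * h / r with hd'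
    calc (2 * m / d + 1) * (((r + m - (r - h) + 1) * d) * ((r + m - (r - h) + 1) * (4 * d)))
        = 4 * (m + h + 1) ^ 2 * (2 * m + d) * d := by
          field_simp
          ring
      _ ≤ 4 * (3 * h) ^ 2 * (2 * m + 1) * d := by
          gcongr
          linarith
      _ = _ := by rw [hd']; ring
  have b₃ : P.real (N ⁻¹' D₃) ≤ (2 * K + 1) * Real.exp (-(ρ / 8) * h) := by
    refine (hN.measureReal_emptyRow_le (by linarith) (by linarith) K).trans (le_of_eq ?_)
    ring_nf
  refine Real.iSup_le (fun A => ?_) (by positivity)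
  have hstat : P.real ((fun ω => F 0 (directedForest ρ (N ω))) ⁻¹' A.1) =
      P.real ((fun ω => F !₂[r, 0] (directedForest ρ (N ω))) ⁻¹' A.1) :=
    congrArg ENNReal.toReal (hN.measure_forest_preimage_eq ρ hFmeas hFinv _ A.2)
  rw [hstat]
  refine (abs_measureReal_preimage_sub_le (D := (N ⁻¹' D₁ ∪ N ⁻¹' D₂) ∪ N ⁻¹' D₃)
    (fun ω hω => ?_) A.1).trans ?_
  · simp only [mem_union, mem_preimage, not_or] at hω
    exact S.apply_tree_eq_apply_forest hω.1.1 hω.1.2 hω.2 hF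
  · have h1 := measureReal_union_le (μ := P) (N ⁻¹' D₁ ∪ N ⁻¹' D₂) (N ⁻¹' D₃)
    have h2 := measureReal_union_le (μ := P) (N ⁻¹' D₁) (N ⁻¹' D₂)
    linarith

/-- The choice `h = r ^ κ` with `κ < 1` is admissible for large `r`. -/
theorem eventually_scales {L ρ κ : ℝ} (hL : 0 < L) (hρ : 0 < ρ) (hκ : 0 < κ) (hκ1 : κ < 1) :
    ∀ᶠ r : ℝ in atTop, Scales L ρ (2 * (L + ρ) + 1) (r ^ κ) r ∧
      4 * (2 * (L + ρ) + 1) * r ^ κ / r ≤ 1 := by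
  set m := 2 * (L + ρ) + 1 with hm
  have hm0 : 0 < m := by linarith
  have hlim : Tendsto (fun r : ℝ => r ^ κ / r) atTop (𝓝 0) := by
    refine (tendsto_rpow_neg_atTop (y := 1 - κ) (by linarith)).congr' ?_
    filter_upwards [eventually_gt_atTop 0] with r hr
    rw [neg_sub, Real.rpow_sub_one hr.ne']
  have hlim' : Tendsto (fun r : ℝ => 4 * m * (r ^ κ / r)) atTop (𝓝 0) := by
    simpa using hlim.const_mul (4 * m)
  filter_upwards [eventually_gt_atTop 0, (tendsto_rpow_atTop hκ).eventually_ge_atTop (8 * m),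
    hlim.eventually_le_const (show (0 : ℝ) < 1 / 4 by norm_num),
    hlim'.eventually_le_const (show (0 : ℝ) < ρ / 4 by linarith),
    hlim'.eventually_le_const one_pos] with r hr h1 h2 h3 h4
  rw [← mul_div_assoc] at h3 h4
  rw [div_le_iff₀ hr] at h2
  exact ⟨⟨hL, hρ, hm, h1, by linarith, h3⟩, h4⟩

theorem eventually_exp_neg_rpow_le {a κ : ℝ} (ha : 0 < a) (hκ : 0 < κ) :
    ∀ᶠ r : ℝ in atTop, Real.exp (-a * r ^ κ) ≤ r⁻¹ := by
  have h := ((isLittleO_exp_neg_mul_rpow_atTop ha (-κ⁻¹)).comp_tendsto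
    (tendsto_rpow_atTop hκ)).bound one_pos
  filter_upwards [h, eventually_gt_atTop 0] with r hr hr0
  simp only [Function.comp_apply, Real.norm_eq_abs, Real.abs_exp, one_mul] at hr
  rwa [← Real.rpow_mul hr0.le, mul_neg, mul_inv_cancel₀ hκ.ne', Real.rpow_neg_one,
    abs_of_pos (inv_pos.2 hr0)] at hr

end RadialPoisson

end
theorem mainTheorem6 {Ω : Type*} [MeasurableSpace Ω] (P : Measure Ω) [IsProbabilityMeasure P]
    (N : Ω → RadialPoisson.Config) (hN : RadialPoisson.IsPoissonProcess P N)
    (ρ : ℝ) (hρ : 0 < ρ)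
    {E : Type*} [MeasurableSpace E] (F : RadialPoisson.Plane → RadialPoisson.OutGraph → E)
    (hFmeas : ∀ X, Measurable (F X))
    (hFlocal : RadialPoisson.IsLocal F)
    (hFinv : RadialPoisson.IsTranslationInvariant F)
    (δ : ℝ) (hδ : 0 < δ) :
    (fun r : ℝ => RadialPoisson.tvDistLaw P
        (fun ω => F !₂[r, 0] (RadialPoisson.radialPoissonTree ρ (N ω)))
        (fun ω => F 0 (RadialPoisson.directedForest ρ (N ω))))
      =O[atTop] (fun r : ℝ => r ^ (-1 + δ)) := by
  obtain ⟨L, hL, hF⟩ := hFlocal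
  set κ := min δ 1 / 3 with hκ
  have hκ0 : 0 < κ := by positivity
  have hκδ : 3 * κ ≤ δ := by linarith [min_le_left δ 1]
  have hκ1 : κ < 1 := by linarith [min_le_right δ 1]
  set m := 2 * (L + ρ) + 1 with hm
  refine IsBigO.of_bound ((12 * (2 * m + 1) ^ 2 * m ^ 2 + 144 * (2 * m + 1) * m) +
    (2 * (⌈L / (ρ / 2)⌉₊ + 1 : ℕ) + 1)) ?_
  filter_upwards [RadialPoisson.eventually_scales hL hρ hκ0 hκ1,
    RadialPoisson.eventually_exp_neg_rpow_le (show 0 < ρ / 8 by linarith) hκ0,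
    eventually_ge_atTop (m ^ 2), eventually_ge_atTop 1] with r hS hexp hr hr1
  have hr0 : 0 < r := by linarith
  have hpow : (r ^ κ) ^ 3 / r ≤ r ^ (-1 + δ) := by
    rw [← Real.rpow_natCast, ← Real.rpow_mul hr0.le, ← Real.rpow_sub_one hr0.ne']
    refine Real.rpow_le_rpow_of_exponent_le hr1 ?_
    push_cast
    linarith
  have hinv : r⁻¹ ≤ r ^ (-1 + δ) := by
    rw [← Real.rpow_neg_one]
    exact Real.rpow_le_rpow_of_exponent_le hr1 (by linarith)
  have hm0 : 0 < m := by linarith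
  have htv := hS.1.tvDistLaw_le hN hr hS.2 (hFmeas 0) hF hFinv
  rw [Real.norm_eq_abs, Real.norm_eq_abs, abs_of_nonneg (RadialPoisson.tvDistLaw_nonneg _ _ _),
    abs_of_pos (Real.rpow_pos_of_pos hr0 _), add_mul]
  refine htv.trans ?_
  gcongr
  exact hexp.trans hinv
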